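/- For $\epsilon\in\mathbb R$ let $$N_0(\epsilon)=\int_{[-\pi,\pi]^2}\delta\big(2(\cos k_1+\cos k_2)+\epsilon\big)\,\frac{dk_1\,dk_2}{(2\pi)^2}$$ be the two-dimensional density of states, i.e. $N_0=\mathcal N'$ where $$\mathcal N(\epsilon)=\frac{1}{(2\pi)^2}\,\mathrm{area}\big\{k\in[-\pi,\pi]^2:\ -2(\cos k_1+\cos k_2)\le\epsilon\big\}.$$ For integers $k,l\ge 0$ and real $w_1<0$, $w_2>1$ set, with $\psi=\Gamma'/\Gamma$ the digamma function, $$A_{k,l}(w_1,w_2)=w_1^k(w_2-1)^l\,\frac{\Gamma(k+\frac12)\,\Gamma(k+l+1)}{\Gamma(k+1)^2\,\Gamma(\frac12-l)\,\Gamma(l+1)^2}\Big\{\ln(-w_1)+\ln(w_2-1)+2\big(\psi(k+l+1)-\psi(k+1)-\psi(l+1)\big)+\psi(k+\tfrac12)+\psi(\tfrac12-l)\Big\}.$$ **Theorem.** The function $\mathcal N$ is differentiable on $(0,4)$, so that $N_0$ is well defined there; $N_0$ is $C^\infty$ on $(0,\delta)$ for some $\delta>0$; and, as $\epsilon\downarrow0$,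 $N_0$ has the asymptotic expansion to all orders $$N_0(\epsilon)\sim-\frac{1}{\pi^2(4-\epsilon)}\sum_{k,l=0}^\infty A_{k,l}\Big(-\frac{\epsilon}{4-\epsilon},\frac{4}{4-\epsilon}\Big),$$ which can be differentiated termwise any finite number of times. Precisely: for all integers $n,M\ge0$ and every finite set $S\subset\mathbb Z_{\ge0}^2$ containing all $(k,l)$ with $k+l<M$, $$\frac{d^n}{d\epsilon^n}N_0(\epsilon)=\sum_{(k,l)\in S}\frac{d^n}{d\epsilon^n}\bigg[-\frac{1}{\pi^2(4-\epsilon)}A_{k,l}\Big(-\frac{\epsilon}{4-\epsilon},\frac{4}{4-\epsilon}\Big)\bigg]+O\Big(\epsilon^{M-n}\ln\tfrac1\epsilon\Big)\qquad(\epsilon\downarrow0).$$ In particular, as $\epsilon\downarrow0$, $$\begin{aligned}N_0(\epsilon)=\;&\frac{\ln(\frac{16}{\epsilon})}{2\pi^2}+\frac{\epsilon^2(\ln(\frac{16}{\epsilon})-1)}{128\pi^2}+\frac{3\epsilon^4(6\ln(\frac{16}{\epsilon})-7)}{2^{16}\pi^2}+\frac53\,\frac{\epsilon^6(30\ln(\frac{16}{\epsilon})-37)}{2^{22}\pi^2}\\&+\frac{35}{3}\,\frac{\epsilon^8(420\ln(\frac{16}{\epsilon})-533)}{2^{33}\pi^2}+\frac{63}{5}\,\frac{\epsilon^{10}(1260\ln(\frac{16}{\epsilon})-1627)}{2^{39}\pi^2}+O\Big(\epsilon^{12}\ln\tfrac1\epsilon\Big),\end{aligned}$$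 and this formula too can be differentiated termwise any number $n\ge0$ of times, with error $O(\epsilon^{12-n}\ln\frac1\epsilon)$. -/

import Mathlib

open Filter Topology Asymptotics Set
open scoped ContDiff

noncomputable section

namespace Hubbard

/-- The two-dimensional tight-binding band relation `ε(k) = -2 (cos k₁ + cos k₂)`. -/
def band (k : ℝ × ℝ) : ℝ :=
  -2 * (Real.cos k.1 + Real.cos k.2)

/-- The integrated density of states
`∫_{[-π,π]²} H(2 (cos k₁ + cos k₂) + ε) dk / (2π)²`, with `H` the indicator function of `[0, ∞)`:
the normalized area of the set of momenta `k ∈ [-π,π]²` whose energy `ε(k)` is at most `ε`. -/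
def integratedDOS (ε : ℝ) : ℝ :=
  (MeasureTheory.volume
    {k : ℝ × ℝ | k ∈ Icc (-Real.pi) Real.pi ×ˢ Icc (-Real.pi) Real.pi ∧ band k ≤ ε}).toReal
    / (2 * Real.pi) ^ 2

/-- The two-dimensional density of states
`N₀(ε) = ∫_{[-π,π]²} δ(2 (cos k₁ + cos k₂) + ε) dk / (2π)²`.
As `δ = H'`, the integral of the delta function is the derivative in `ε` of the integral of
the step function. -/
def dos (ε : ℝ) : ℝ :=
  deriv integratedDOS ε

/-- The digamma function `ψ = Γ' / Γ` on the real line. -/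
def psi (x : ℝ) : ℝ :=
  deriv Real.Gamma x / Real.Gamma x

/-- The functions `A_{k,l}(w₁, w₂)` for real `w₁ < 0` and `w₂ > 1`, where the principal
logarithms of `-w₁` and `w₂ - 1` are the real ones. -/
def A (k l : ℕ) (w₁ w₂ : ℝ) : ℝ :=
  w₁ ^ k * (w₂ - 1) ^ l *
    (Real.Gamma ((k : ℝ) + 1 / 2) * Real.Gamma ((k : ℝ) + (l : ℝ) + 1) /
      (Real.Gamma ((k : ℝ) + 1) ^ 2 * Real.Gamma (1 / 2 - (l : ℝ)) *
        Real.Gamma ((l : ℝ) + 1) ^ 2)) *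
    (Real.log (-w₁) + Real.log (w₂ - 1)
      + 2 * (psi ((k : ℝ) + (l : ℝ) + 1) - psi ((k : ℝ) + 1) - psi ((l : ℝ) + 1))
      + psi ((k : ℝ) + 1 / 2) + psi (1 / 2 - (l : ℝ)))

/-- The `(k,l)`-term of the expansion of `N₀(ε)`, including the prefactor. -/
def expansionTerm (k l : ℕ) (ε : ℝ) : ℝ :=
  -(1 / (Real.pi ^ 2 * (4 - ε))) * A k l (-(ε / (4 - ε))) (4 / (4 - ε))

/-- The first several terms of the expansion of `N₀(ε)`. -/
def firstTerms (ε : ℝ) : ℝ :=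
  Real.log (16 / ε) / (2 * Real.pi ^ 2)
    + ε ^ 2 * (Real.log (16 / ε) - 1) / (128 * Real.pi ^ 2)
    + 3 * ε ^ 4 * (6 * Real.log (16 / ε) - 7) / (2 ^ 16 * Real.pi ^ 2)
    + 5 / 3 * (ε ^ 6 * (30 * Real.log (16 / ε) - 37) / (2 ^ 22 * Real.pi ^ 2))
    + 35 / 3 * (ε ^ 8 * (420 * Real.log (16 / ε) - 533) / (2 ^ 33 * Real.pi ^ 2))
    + 63 / 5 * (ε ^ 10 * (1260 * Real.log (16 / ε) - 1627) / (2 ^ 39 * Real.pi ^ 2))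

end Hubbard

end

/-! For `0 < ε < 4` the density of states is an explicit complete elliptic integral, and near `ε =
0` this integral is a logarithmic Frobenius solution of a Fuchsian equation. Both expansions come
from recognizing their series as that same solution.

Elliptic integral. One momentum integration turns the area into an integral of an arccosine, and
substitutions with a fixed interval allow differentiation under the integral sign. With `x =
ε/(4-ε)`, `hasDerivAt_integratedDOS` gives `N₀(ε) = 4/(π²(4-ε)) T(4x(1+x))`, where `T` is `ellInt`.
Legendre's equation for `T` becomes `(x(1+x)(1+2x) y')' + (1+2x) y = 0`, and `T(4x(1+x)) = -(log
x)/2 + log 2 + o(1)`.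

Uniqueness. By constancy of the Wronskian, a solution tending to `0` at `0⁺` vanishes near `0⁺`
(`IsFluxPair.eventually_eq_zero`). A solution is therefore pinned down by its logarithmic
singularity and its constant term (`eventually_ellInt_eq`).

Double series. For `w₁ = -x`, `w₂ = 1+x` the terms with `k+l = m` add up to `2 x^m (c_m log x +
b_m)`. Up to the factor `(-1)^m m!`, `c_m` is the convolution square of a hypergeometric sequence,
and `b_m` is its derivative when the total degree is shifted. Calculating in dual numbers, one
three-term recursion yields the Frobenius recursions for both `c` and `b`.

Collected terms. Landen's transformation provides a second form of the solution, in `v = (x/(1+x))²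
= (ε/4)²`. This explains why only even powers of `ε` occur, and its first six coefficients are the
explicit terms.

Differentiation. All remainders have the form `t^j (a(t) log t + b(t))` with `a`, `b` analytic at
`0`. Differentiation preserves this form and lowers `j` by one, so termwise differentiability needs
no further estimate. -/

namespace Hubbard

/-! ### Functions of the form `t ^ j * (a t * log t + b t)` near `0⁺` -/

/-- `f t = t ^ j * (a t * log t + b t)` for small `t > 0`, with `a` and `b` analytic at `0`. -/
def IsLogPower (j : ℤ) (f : ℝ → ℝ) : Prop :=
  ∃ a b : ℝ → ℝ, AnalyticAt ℝ a 0 ∧ AnalyticAt ℝ b 0 ∧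
    ∀ᶠ t in 𝓝[>] (0 : ℝ), f t = t ^ j * (a t * Real.log t + b t)

theorem eventually_nhds_of_eventually_nhdsGT {p : ℝ → Prop}
    (h : ∀ᶠ t in 𝓝[>] (0 : ℝ), p t) : ∀ᶠ t in 𝓝[>] (0 : ℝ), ∀ᶠ s in 𝓝 t, p s := by
  filter_upwards [eventually_eventually_nhdsWithin.2 h, self_mem_nhdsWithin] with t ht h0
  rwa [isOpen_Ioi.nhdsWithin_eq h0] at ht

theorem eventually_nhdsGT_analyticAt {a : ℝ → ℝ} (ha : AnalyticAt ℝ a 0) :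
    ∀ᶠ t in 𝓝[>] (0 : ℝ), AnalyticAt ℝ a t :=
  nhdsWithin_le_nhds ha.eventually_analyticAt

/-- The Euler operator `t d/dt` preserves the form with `j` fixed: differentiating the logarithm
only feeds `a` into the new `b`. Dividing by `t` costs one power. -/
theorem IsLogPower.deriv {j : ℤ} {f : ℝ → ℝ} (hf : IsLogPower j f) :
    IsLogPower (j - 1) (deriv f) := by
  obtain ⟨a, b, ha, hb, h⟩ := hf
  refine ⟨fun t => j * a t + t * _root_.deriv a t,
    fun t => a t + j * b t + t * _root_.deriv b t, ?_, ?_, ?_⟩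
  · exact (analyticAt_const.mul ha).add (analyticAt_id.mul ha.deriv)
  · exact (ha.add (analyticAt_const.mul hb)).add (analyticAt_id.mul hb.deriv)
  filter_upwards [eventually_nhds_of_eventually_nhdsGT h, self_mem_nhdsWithin,
    eventually_nhdsGT_analyticAt ha, eventually_nhdsGT_analyticAt hb] with t ht h0 hat hbt
  have h0 : t ≠ 0 := ne_of_gt h0
  have hd := (hasDerivAt_zpow j t (Or.inl h0)).mul
    ((hat.differentiableAt.hasDerivAt.mul (Real.hasDerivAt_log h0)).add
      hbt.differentiableAt.hasDerivAt)
  have e : f =ᶠ[𝓝 t] fun s => s ^ j * (a s * Real.log s + b s) := ht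
  rw [e.deriv_eq]
  refine HasDerivAt.deriv (hd.congr_deriv ?_)
  have hz : t ^ j = t ^ (j - 1) * t := by rw [← zpow_add_one₀ h0]; simp
  simp only [Pi.add_apply, Pi.mul_apply]
  rw [hz]
  field_simp
  ring

theorem IsLogPower.iteratedDeriv {j : ℤ} {f : ℝ → ℝ} (hf : IsLogPower j f) (n : ℕ) :
    IsLogPower (j - n) (iteratedDeriv n f) := by
  induction n with
  | zero => simpa using hf
  | succ n ih =>
    rw [iteratedDeriv_succ]
    have := ih.deriv
    convert this using 1
    push_cast; ring

theorem IsLogPower.isBigO {j : ℤ} {f : ℝ → ℝ} (hf : IsLogPower j f) :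
    f =O[𝓝[>] (0 : ℝ)] fun t => t ^ j * Real.log (1 / t) := by
  obtain ⟨a, b, ha, hb, h⟩ := hf
  refine (IsBigO.mul (isBigO_refl (fun t : ℝ => t ^ j) _) ?_).congr' (h.mono fun t ht => ht.symm)
    EventuallyEq.rfl
  have hlog : Tendsto (fun t : ℝ => Real.log (1 / t)) (𝓝[>] 0) atTop := by
    simp only [one_div]
    exact Real.tendsto_log_atTop.comp tendsto_inv_nhdsGT_zero
  have h1 : (fun _ : ℝ => (1 : ℝ)) =O[𝓝[>] (0 : ℝ)] fun t => Real.log (1 / t) := by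
    refine IsBigO.of_bound 1 ?_
    filter_upwards [hlog.eventually_ge_atTop 1] with t ht
    rw [Real.norm_eq_abs, Real.norm_eq_abs, abs_one, one_mul]
    exact ht.trans (le_abs_self _)
  have hA : a =O[𝓝[>] (0 : ℝ)] fun _ => (1 : ℝ) :=
    (ha.continuousAt.tendsto.mono_left nhdsWithin_le_nhds).isBigO_one ℝ
  have hB : b =O[𝓝[>] (0 : ℝ)] fun _ => (1 : ℝ) :=
    (hb.continuousAt.tendsto.mono_left nhdsWithin_le_nhds).isBigO_one ℝ
  have h2 : Real.log =O[𝓝[>] (0 : ℝ)] fun t => Real.log (1 / t) :=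
    IsBigO.of_bound 1 (Eventually.of_forall fun t => by simp)
  refine IsBigO.add ?_ (hB.trans h1)
  simpa using hA.mul h2

theorem IsLogPower.contDiffAt {j : ℤ} {f : ℝ → ℝ} (hf : IsLogPower j f) :
    ∀ᶠ t in 𝓝[>] (0 : ℝ), ContDiffAt ℝ ∞ f t := by
  obtain ⟨a, b, ha, hb, h⟩ := hf
  filter_upwards [eventually_nhds_of_eventually_nhdsGT h, self_mem_nhdsWithin,
    eventually_nhdsGT_analyticAt ha, eventually_nhdsGT_analyticAt hb] with t ht h0 hat hbt
  have h0 : t ≠ 0 := ne_of_gt h0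
  refine ContDiffAt.congr_of_eventuallyEq ?_ ht
  have h1 : AnalyticAt ℝ (fun t : ℝ => t ^ j) t := analyticAt_id.fun_zpow h0
  exact (h1.contDiffAt).mul
    ((hat.contDiffAt.mul (Real.contDiffAt_log.2 h0)).add hbt.contDiffAt)

theorem IsLogPower.congr {j : ℤ} {f g : ℝ → ℝ} (hf : IsLogPower j f)
    (h : ∀ᶠ t in 𝓝[>] (0 : ℝ), g t = f t) : IsLogPower j g := by
  obtain ⟨a, b, ha, hb, h'⟩ := hf
  exact ⟨a, b, ha, hb, by filter_upwards [h, h'] with t h1 h2; rw [h1, h2]⟩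

theorem IsLogPower.sub {j : ℤ} {f g : ℝ → ℝ} (hf : IsLogPower j f) (hg : IsLogPower j g) :
    IsLogPower j fun t => f t - g t := by
  obtain ⟨a, b, ha, hb, h⟩ := hf
  obtain ⟨a', b', ha', hb', h'⟩ := hg
  refine ⟨fun t => a t - a' t, fun t => b t - b' t, ha.sub ha', hb.sub hb', ?_⟩
  filter_upwards [h, h'] with t h1 h2
  rw [h1, h2]; ring

theorem IsLogPower.sum {ι : Type*} {j : ℤ} {f : ι → ℝ → ℝ} (s : Finset ι)
    (hf : ∀ i ∈ s, IsLogPower j (f i)) : IsLogPower j fun t => ∑ i ∈ s, f i t := by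
  classical
  induction s using Finset.induction_on with
  | empty => exact ⟨0, 0, analyticAt_const, analyticAt_const, by simp⟩
  | insert i s hi ih =>
    obtain ⟨a, b, ha, hb, h⟩ := hf i (Finset.mem_insert_self _ _)
    obtain ⟨a', b', ha', hb', h'⟩ := ih fun k hk => hf k (Finset.mem_insert_of_mem hk)
    refine ⟨fun t => a t + a' t, fun t => b t + b' t, ha.add ha', hb.add hb', ?_⟩
    filter_upwards [h, h'] with t h1 h2
    rw [Finset.sum_insert hi, h1, h2]; ring

/-- A function `t ^ j * (a t * log t + b t)` with `j : ℕ` can be regarded as one with `j = 0`. -/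
theorem IsLogPower.zero_of_nat {M : ℕ} {f : ℝ → ℝ} (hf : IsLogPower M f) : IsLogPower 0 f := by
  obtain ⟨a, b, ha, hb, h⟩ := hf
  refine ⟨fun t => t ^ M * a t, fun t => t ^ M * b t, (analyticAt_id.pow M).mul ha,
    (analyticAt_id.pow M).mul hb, ?_⟩
  filter_upwards [h] with t ht
  rw [ht]; simp; ring

theorem IsLogPower.mul_analytic {j : ℤ} {f g : ℝ → ℝ} (hf : IsLogPower j f)
    (hg : AnalyticAt ℝ g 0) : IsLogPower j fun t => g t * f t := by
  obtain ⟨a, b, ha, hb, h⟩ := hf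
  refine ⟨fun t => g t * a t, fun t => g t * b t, hg.mul ha, hg.mul hb, ?_⟩
  filter_upwards [h] with t ht
  rw [ht]; ring

/-- Composition with `t ↦ t * φ t`, where `φ` is analytic and `φ 0 > 0`. -/
theorem IsLogPower.comp_mul {M : ℕ} {f φ : ℝ → ℝ} (hf : IsLogPower M f)
    (hφ : AnalyticAt ℝ φ 0) (h0 : 0 < φ 0) : IsLogPower M fun t => f (t * φ t) := by
  obtain ⟨a, b, ha, hb, h⟩ := hf
  have hx : AnalyticAt ℝ (fun t => t * φ t) 0 := analyticAt_id.mul hφ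
  have hpos : ∀ᶠ t in 𝓝[>] (0 : ℝ), 0 < φ t :=
    nhdsWithin_le_nhds (hφ.continuousAt.eventually (lt_mem_nhds h0))
  have hx0 : (fun t => t * φ t) 0 = 0 := by simp
  have hA : AnalyticAt ℝ (fun t => a (t * φ t)) 0 := by
    refine AnalyticAt.fun_comp ?_ hx; simpa using ha
  have hB : AnalyticAt ℝ (fun t => b (t * φ t)) 0 := by
    refine AnalyticAt.fun_comp ?_ hx; simpa using hb
  have hL : AnalyticAt ℝ (fun t => Real.log (φ t)) 0 := hφ.log h0
  -- `log (t φ t) = log t + log (φ t)`, and the last summand is analytic because `φ 0 > 0`; it is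
  -- absorbed into the regular part.
  refine ⟨fun t => φ t ^ M * a (t * φ t),
    fun t => φ t ^ M * (a (t * φ t) * Real.log (φ t) + b (t * φ t)),
    (hφ.pow M).mul hA, (hφ.pow M).mul ((hA.mul hL).add hB), ?_⟩
  have ht : Tendsto (fun t => t * φ t) (𝓝[>] 0) (𝓝[>] 0) := by
    refine tendsto_nhdsWithin_iff.2 ⟨?_, ?_⟩
    · have := hx.continuousAt.tendsto
      simp only [zero_mul] at this
      exact this.mono_left nhdsWithin_le_nhds
    · filter_upwards [hpos, self_mem_nhdsWithin] with t h1 h2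
      exact mul_pos h2 h1
  filter_upwards [ht.eventually h, hpos, self_mem_nhdsWithin] with t h1 h2 h3
  have h3 : (0 : ℝ) < t := h3
  rw [h1, Real.log_mul h3.ne' h2.ne']
  simp only [zpow_natCast, mul_pow]
  ring

/-- Termwise differentiation of an expansion whose remainder is a logarithmic power. -/
theorem isBigO_iteratedDeriv_sub_sum {ι : Type*} {M : ℕ} {f : ℝ → ℝ} {g : ι → ℝ → ℝ}
    (s : Finset ι) (hg : ∀ i ∈ s, IsLogPower 0 (g i))
    (h : IsLogPower M fun t => f t - ∑ i ∈ s, g i t) (n : ℕ) :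
    (fun t => iteratedDeriv n f t - ∑ i ∈ s, iteratedDeriv n (g i) t)
      =O[𝓝[>] (0 : ℝ)] fun t => t ^ ((M : ℤ) - n) * Real.log (1 / t) := by
  have hs := IsLogPower.sum s hg
  have hf : IsLogPower 0 f := by
    obtain ⟨a, b, ha, hb, h1⟩ := h.zero_of_nat
    obtain ⟨a', b', ha', hb', h2⟩ := hs
    refine ⟨fun t => a t + a' t, fun t => b t + b' t, ha.add ha', hb.add hb', ?_⟩
    filter_upwards [h1, h2] with t h1 h2
    linear_combination h1 + h2
  refine (h.iteratedDeriv n).isBigO.congr' ?_ EventuallyEq.rfl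
  -- Smoothness of each function near `0⁺` is what lets the iterated derivative of the remainder
  -- split over the difference and the sum.
  have hall : ∀ᶠ t in 𝓝[>] (0 : ℝ), ∀ i ∈ s, ContDiffAt ℝ ∞ (g i) t := by
    rw [Finset.eventually_all]
    exact fun i hi => (hg i hi).contDiffAt
  filter_upwards [hf.contDiffAt, hs.contDiffAt, hall] with t h1 h2 h3
  have hn : ((n : ℕ∞) : WithTop ℕ∞) ≤ ∞ := by exact_mod_cast le_top
  rw [iteratedDeriv_fun_sub (h1.of_le hn) (h2.of_le hn),
    iteratedDeriv_fun_sum (fun i hi => (h3 i hi).of_le hn)]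

/-! ### Power series and Frobenius solutions -/

/-- The power series with coefficients `c`. -/
noncomputable def powerSum (c : ℕ → ℝ) (t : ℝ) : ℝ :=
  ∑' m, c m * t ^ m

/-- `c m = O(R ^ m)`. -/
def GeomBounded (R : ℝ) (c : ℕ → ℝ) : Prop :=
  ∃ C : ℝ, ∀ m, |c m| ≤ C * R ^ m

/-- The coefficients of `t * d/dt` of a power series. -/
def eulerCoeff (c : ℕ → ℝ) (m : ℕ) : ℝ :=
  m * c m

/-- The coefficients of `t` times a power series. -/
def shiftCoeff {K : Type*} [Zero K] (c : ℕ → K) : ℕ → K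
  | 0 => 0
  | m + 1 => c m

variable {R : ℝ} {c b : ℕ → ℝ}

theorem GeomBounded.exists_nonneg (hc : GeomBounded R c) :
    ∃ C : ℝ, 0 ≤ C ∧ ∀ m, |c m| ≤ C * R ^ m := by
  obtain ⟨C, hC⟩ := hc
  refine ⟨C, ?_, hC⟩
  have := (abs_nonneg _).trans (hC 0)
  simpa using this

theorem GeomBounded.eulerCoeff (hc : GeomBounded R c) :
    GeomBounded (2 * R) (eulerCoeff c) := by
  obtain ⟨C, hC0, hC⟩ := hc.exists_nonneg
  refine ⟨C, fun m => ?_⟩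
  have h2 : (m : ℝ) ≤ 2 ^ m := by exact_mod_cast (Nat.lt_two_pow_self).le
  rw [Hubbard.eulerCoeff, abs_mul, Nat.abs_cast, mul_pow]
  calc (m : ℝ) * |c m| ≤ 2 ^ m * (C * R ^ m) := by gcongr; exact hC m
    _ = C * (2 ^ m * R ^ m) := by ring

theorem GeomBounded.add_right (hc : GeomBounded R c) (M : ℕ) :
    GeomBounded R fun m => c (m + M) := by
  obtain ⟨C, hC⟩ := hc
  exact ⟨C * R ^ M, fun m => (hC _).trans (by rw [pow_add]; apply le_of_eq; ring)⟩

/-- Induction on two consecutive terms: each step multiplies a common bound by at most `1 + α + β`,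
where the `1` pays for the inhomogeneity. -/
theorem geomBounded_of_le {α β ε : ℝ} (hα : 0 ≤ α) (hβ : 0 ≤ β) (hR : 1 + α + β ≤ R)
    (h : ∀ m, |c (m + 1)| ≤ α * |c m| + β * |shiftCoeff c m| + ε * R ^ m) :
    GeomBounded R c := by
  have hR1 : 1 ≤ R := by linarith
  have hR0 : 0 < R := by linarith
  obtain ⟨D, hD⟩ : ∃ D, D = max |c 0| ε := ⟨_, rfl⟩
  have h0 : |c 0| ≤ D := hD ▸ le_max_left _ _
  have hε : ε ≤ D := hD ▸ le_max_right _ _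
  have hD0 : 0 ≤ D := (abs_nonneg _).trans h0
  have key : ∀ m, |c m| ≤ D * R ^ m ∧ |shiftCoeff c m| ≤ D * R ^ m := by
    intro m
    induction m with
    | zero => simpa [shiftCoeff, hD0] using h0
    | succ m ih =>
      obtain ⟨h1, h2⟩ := ih
      refine ⟨(h m).trans ?_, h1.trans ?_⟩
      · calc α * |c m| + β * |shiftCoeff c m| + ε * R ^ m
            ≤ α * (D * R ^ m) + β * (D * R ^ m) + D * R ^ m := by gcongr
          _ = (1 + α + β) * (D * R ^ m) := by ring
          _ ≤ R * (D * R ^ m) := by gcongr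
          _ = D * R ^ (m + 1) := by ring
      · gcongr
        omega
  exact ⟨D, fun m => (key m).1⟩

/-- Solutions of the (inhomogeneous) three-term recursions of Frobenius type grow at most
geometrically. -/
theorem geomBounded_of_recurrence {p₁ p₂ r₀ r₁ ε : ℝ} {f : ℕ → ℝ}
    (hR : 1 + (|p₁| + |r₀|) + (|p₂| + |r₁|) ≤ R)
    (hf : ∀ m : ℕ, |f m| ≤ (m + 1 : ℝ) ^ 2 * (ε * R ^ m))
    (hc : ∀ m : ℕ, (m + 1 : ℝ) ^ 2 * c (m + 1) + (p₁ * (m * (m + 1)) + r₀) * c m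
      + (p₂ * (m ^ 2 - 1) + r₁) * shiftCoeff c m + f m = 0) : GeomBounded R c := by
  refine geomBounded_of_le (α := |p₁| + |r₀|) (β := |p₂| + |r₁|) (ε := ε) (by positivity)
    (by positivity) hR fun m => ?_
  have hm : (0 : ℝ) ≤ m := Nat.cast_nonneg m
  have h1 : |p₁ * (m * (m + 1)) + r₀| ≤ (m + 1 : ℝ) ^ 2 * (|p₁| + |r₀|) := by
    refine (abs_add_le _ _).trans ?_
    rw [abs_mul, abs_of_nonneg (by positivity : (0 : ℝ) ≤ m * (m + 1))]
    nlinarith [abs_nonneg p₁, abs_nonneg r₀, mul_nonneg (abs_nonneg p₁) hm,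
      mul_nonneg (abs_nonneg r₀) hm, mul_nonneg (abs_nonneg r₀) (mul_nonneg hm hm)]
  have h2 : |p₂ * (m ^ 2 - 1) + r₁| ≤ (m + 1 : ℝ) ^ 2 * (|p₂| + |r₁|) := by
    refine (abs_add_le _ _).trans ?_
    have h3 : |(m : ℝ) ^ 2 - 1| ≤ (m + 1 : ℝ) ^ 2 := abs_le.2 ⟨by nlinarith, by nlinarith⟩
    rw [abs_mul]
    have h4 : |r₁| ≤ (m + 1 : ℝ) ^ 2 * |r₁| := by
      nlinarith [abs_nonneg r₁, mul_nonneg (abs_nonneg r₁) hm,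
        mul_nonneg (abs_nonneg r₁) (mul_nonneg hm hm)]
    nlinarith [mul_le_mul_of_nonneg_left h3 (abs_nonneg p₂)]
  have hpos : (0 : ℝ) < (m + 1 : ℝ) ^ 2 := by positivity
  refine le_of_mul_le_mul_left ?_ hpos
  have e : (m + 1 : ℝ) ^ 2 * c (m + 1) = -((p₁ * (m * (m + 1)) + r₀) * c m
      + (p₂ * (m ^ 2 - 1) + r₁) * shiftCoeff c m + f m) := by linear_combination hc m
  calc (m + 1 : ℝ) ^ 2 * |c (m + 1)| = |(m + 1 : ℝ) ^ 2 * c (m + 1)| := by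
        rw [abs_mul, abs_of_pos hpos]
    _ ≤ |p₁ * (m * (m + 1)) + r₀| * |c m| + |p₂ * (m ^ 2 - 1) + r₁| * |shiftCoeff c m|
        + |f m| := by
      rw [e, abs_neg, ← abs_mul, ← abs_mul]
      exact (abs_add_le _ _).trans (by gcongr; exact abs_add_le _ _)
    _ ≤ (m + 1 : ℝ) ^ 2 * (|p₁| + |r₀|) * |c m| + (m + 1 : ℝ) ^ 2 * (|p₂| + |r₁|)
        * |shiftCoeff c m| + (m + 1 : ℝ) ^ 2 * (ε * R ^ m) := by
      gcongr; exact hf m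
    _ = _ := by ring

theorem GeomBounded.shiftCoeff (hR : 1 ≤ R) (hc : GeomBounded R c) :
    GeomBounded R (shiftCoeff c) := by
  obtain ⟨C, hC0, hC⟩ := hc.exists_nonneg
  refine ⟨C, fun m => ?_⟩
  rcases m with _ | m
  · simpa [Hubbard.shiftCoeff] using hC0
  · refine (hC m).trans ?_
    gcongr
    omega

/-- The growth of the coefficients of the logarithmic Frobenius solution. -/
theorem geomBounded_of_log_recurrence {p₁ p₂ r₀ r₁ : ℝ}
    (hR : 1 + (|p₁| + |r₀|) + (|p₂| + |r₁|) ≤ R) (hc : GeomBounded R c)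
    (hrb : ∀ m : ℕ, (m + 1 : ℝ) ^ 2 * b (m + 1) + (p₁ * (m * (m + 1)) + r₀) * b m
      + (p₂ * (m ^ 2 - 1) + r₁) * Hubbard.shiftCoeff b m
      + (2 * (m + 1) * c (m + 1) + p₁ * (2 * m + 1) * c m
        + 2 * p₂ * m * Hubbard.shiftCoeff c m) = 0) : GeomBounded R b := by
  have hR1 : 1 ≤ R := by
    linarith [abs_nonneg p₁, abs_nonneg p₂, abs_nonneg r₀, abs_nonneg r₁]
  obtain ⟨C, hC0, hC⟩ := hc.exists_nonneg
  obtain ⟨D, hD0, hD⟩ := (hc.shiftCoeff hR1).exists_nonneg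
  refine geomBounded_of_recurrence (ε := 2 * (C * R) + 2 * |p₁| * C + 2 * |p₂| * D) hR
    (fun m => ?_) hrb
  have hm : (0 : ℝ) ≤ m := Nat.cast_nonneg m
  have h1 : (m : ℝ) + 1 ≤ (m + 1) ^ 2 := by nlinarith
  calc |2 * ((m : ℝ) + 1) * c (m + 1) + p₁ * (2 * m + 1) * c m
        + 2 * p₂ * m * Hubbard.shiftCoeff c m|
      ≤ |2 * ((m : ℝ) + 1) * c (m + 1)| + |p₁ * (2 * m + 1) * c m|
        + |2 * p₂ * m * Hubbard.shiftCoeff c m| :=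
        (abs_add_le _ _).trans (by gcongr; exact abs_add_le _ _)
    _ = 2 * ((m : ℝ) + 1) * |c (m + 1)| + |p₁| * (2 * m + 1) * |c m|
        + 2 * |p₂| * m * |Hubbard.shiftCoeff c m| := by
      simp only [abs_mul, abs_two, abs_of_nonneg hm, abs_of_nonneg (by positivity : (0:ℝ) ≤ m + 1),
        abs_of_nonneg (by positivity : (0:ℝ) ≤ 2 * m + 1)]
    _ ≤ 2 * ((m : ℝ) + 1) * (C * R ^ (m + 1)) + |p₁| * (2 * (m + 1)) * (C * R ^ m)
        + 2 * |p₂| * (m + 1) * (D * R ^ m) := by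
      gcongr
      · exact hC _
      · linarith
      · exact hC _
      · linarith
      · exact hD _
    _ = ((m : ℝ) + 1) * ((2 * (C * R) + 2 * |p₁| * C + 2 * |p₂| * D) * R ^ m) := by ring
    _ ≤ _ := by gcongr

theorem GeomBounded.hasSum (hR : 0 ≤ R) (hc : GeomBounded R c) {t : ℝ} (ht : R * |t| < 1) :
    HasSum (fun m => c m * t ^ m) (powerSum c t) := by
  refine Summable.hasSum ?_
  obtain ⟨C, hC0, hC⟩ := hc.exists_nonneg
  refine Summable.of_norm_bounded
    ((summable_geometric_of_lt_one (by positivity) ht).mul_left C) fun m => ?_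
  rw [Real.norm_eq_abs, abs_mul, abs_pow, mul_pow, ← mul_assoc]
  gcongr
  exact hC m

theorem GeomBounded.analyticAt (hR : 0 < R) (hc : GeomBounded R c) :
    AnalyticAt ℝ (powerSum c) 0 := by
  obtain ⟨C, hC0, hC⟩ := hc.exists_nonneg
  have e : powerSum c = (FormalMultilinearSeries.ofScalars ℝ c).sum := by
    have := FormalMultilinearSeries.ofScalarsSum_eq_tsum (E := ℝ) c
    rw [FormalMultilinearSeries.ofScalarsSum] at this
    rw [this]
    rfl
  rw [e]
  have hr : ((Real.toNNReal R⁻¹ : NNReal) : ENNReal)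
      ≤ (FormalMultilinearSeries.ofScalars ℝ c).radius := by
    refine FormalMultilinearSeries.le_radius_of_bound _ C fun n => ?_
    rw [FormalMultilinearSeries.ofScalars_norm, Real.coe_toNNReal _ (by positivity), inv_pow,
      Real.norm_eq_abs, ← div_eq_mul_inv, div_le_iff₀ (by positivity)]
    exact hC n
  refine (FormalMultilinearSeries.hasFPowerSeriesOnBall _ (lt_of_lt_of_le ?_ hr)).analyticAt
  simpa using hR

theorem GeomBounded.hasDerivAt (hR : 0 < R) (hc : GeomBounded R c) {t : ℝ} (h0 : t ≠ 0)
    (ht : 2 * R * |t| < 1) :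
    HasDerivAt (powerSum c) (powerSum (Hubbard.eulerCoeff c) t / t) t := by
  obtain ⟨C, hC0, hC⟩ := (hc.eulerCoeff).exists_nonneg
  -- A slightly larger interval `(-s, s)` with `2 R s < 1` gives a summable majorant for the
  -- differentiated series; the factor 2 comes from `m ≤ 2 ^ m`.
  obtain ⟨s, hts, hs⟩ := exists_between (show |t| < (2 * R)⁻¹ by
    rw [lt_inv_comm₀ (abs_pos.2 h0) (by positivity), ← one_div, lt_div_iff₀ (abs_pos.2 h0)]
    exact ht)
  have hs0 : 0 < s := (abs_nonneg t).trans_lt hts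
  have hs1 : 2 * R * s < 1 := by
    rw [lt_inv_comm₀ hs0 (by positivity), ← one_div, lt_div_iff₀ hs0] at hs; exact hs
  have hu : Summable fun n : ℕ => C / s * (2 * R * s) ^ n :=
    (summable_geometric_of_lt_one (by positivity) hs1).mul_left _
  have key := hasDerivAt_tsum_of_isPreconnected (t := Ioo (-s) s) (y := t) (y₀ := 0)
    (g := fun n y => c n * y ^ n) (g' := fun n y => c n * (n * y ^ (n - 1))) hu isOpen_Ioo
    isPreconnected_Ioo (fun n y _ => (hasDerivAt_pow n y).const_mul (c n)) (fun n y hy => ?_)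
    (by constructor <;> simp [hs0]) (hc.hasSum hR.le (by simp)).summable (abs_lt.1 hts)
  · refine key.congr_deriv ?_
    rw [powerSum, ← tsum_div_const]
    refine tsum_congr fun n => ?_
    rcases n with _ | n
    · simp [Hubbard.eulerCoeff]
    · simp only [Hubbard.eulerCoeff, add_tsub_cancel_right]; field_simp; ring
  · have hys : |y| ≤ s := (abs_lt.2 hy).le
    rw [Real.norm_eq_abs]
    rcases n with _ | n
    · simp; positivity
    · have := hC (n + 1)
      rw [Hubbard.eulerCoeff, abs_mul, Nat.abs_cast] at this
      simp only [add_tsub_cancel_right]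
      rw [abs_mul, abs_mul, Nat.abs_cast, abs_pow]
      calc |c (n + 1)| * (((n + 1 : ℕ) : ℝ) * |y| ^ n)
          = (((n + 1 : ℕ) : ℝ) * |c (n + 1)|) * |y| ^ n := by ring
        _ ≤ (C * (2 * R) ^ (n + 1)) * s ^ n := by gcongr
        _ = C / s * (2 * R * s) ^ (n + 1) := by field_simp; ring

theorem hasSum_shiftCoeff {t S : ℝ} (h : HasSum (fun m => c m * t ^ m) S) :
    HasSum (fun m => shiftCoeff c m * t ^ m) (t * S) := by
  refine (hasSum_nat_add_iff' 1).1 ?_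
  simp only [Finset.range_one, Finset.sum_singleton, shiftCoeff, zero_mul, sub_zero]
  have e : (fun m => c m * t ^ (m + 1)) = fun m => t * (c m * t ^ m) := funext fun m => by ring
  rw [e]
  exact h.mul_left t

theorem eq_zero_of_hasSum {f : ℕ → ℝ} {S : ℝ} (h : HasSum f S) (hf : ∀ m, f m = 0) : S = 0 := by
  obtain rfl : f = fun _ => 0 := funext hf
  exact h.unique hasSum_zero

/-! ### The equation in flux form: Frobenius solutions and uniqueness -/

/-- `y` solves `(t p y')' + r y = 0` on `(0, ρ)` with flux `w = t p y'`. -/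
def IsFluxPair (p r : ℝ → ℝ) (ρ : ℝ) (y w : ℝ → ℝ) : Prop :=
  ∀ t ∈ Ioo 0 ρ, HasDerivAt y (w t / (t * p t)) t ∧ HasDerivAt w (-(r t) * y t) t

/-- Frobenius solutions: the recursions for the coefficients of the two power series in
`c(t) log t + b(t)` imply the differential equation. -/
theorem isFluxPair_frobenius {p₁ p₂ r₀ r₁ : ℝ} (hR : 0 < R) (hc : GeomBounded R c)
    (hb : GeomBounded R b)
    (hrc : ∀ m : ℕ, (m + 1 : ℝ) ^ 2 * c (m + 1) + (p₁ * (m * (m + 1)) + r₀) * c m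
      + (p₂ * (m ^ 2 - 1) + r₁) * shiftCoeff c m = 0)
    (hrb : ∀ m : ℕ, (m + 1 : ℝ) ^ 2 * b (m + 1) + (p₁ * (m * (m + 1)) + r₀) * b m
      + (p₂ * (m ^ 2 - 1) + r₁) * shiftCoeff b m
      + (2 * (m + 1) * c (m + 1) + p₁ * (2 * m + 1) * c m + 2 * p₂ * m * shiftCoeff c m) = 0)
    {ρ : ℝ} (hρ : 4 * R * ρ ≤ 1) (hp : ∀ t ∈ Ioo 0 ρ, 1 + p₁ * t + p₂ * t ^ 2 ≠ 0) :
    ∃ w, IsFluxPair (fun t => 1 + p₁ * t + p₂ * t ^ 2) (fun t => r₀ + r₁ * t) ρ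
      (fun t => powerSum c t * Real.log t + powerSum b t) w := by
  -- The flux is `p` times the Euler derivative of `y`. Each Euler derivative doubles the geometric
  -- rate, and two are needed, whence the condition `4 R ρ ≤ 1`.
  refine ⟨fun t => (1 + p₁ * t + p₂ * t ^ 2) * (powerSum (eulerCoeff c) t * Real.log t
    + powerSum c t + powerSum (eulerCoeff b) t), fun t ht => ?_⟩
  have h0 : t ≠ 0 := ht.1.ne'
  have hpt := hp t ht
  have h4 : 4 * R * |t| < 1 := by
    rw [abs_of_pos ht.1]
    exact lt_of_lt_of_le (by have := ht.2; gcongr) hρ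
  have h2 : 2 * R * |t| < 1 := lt_of_le_of_lt (by gcongr; norm_num) h4
  have h1 : R * |t| < 1 := lt_of_le_of_lt (by nlinarith [mul_nonneg hR.le (abs_nonneg t)]) h2
  have hc1 := hc.eulerCoeff
  have hb1 := hb.eulerCoeff
  have hc2 := hc1.eulerCoeff
  have hb2 := hb1.eulerCoeff
  have h4' : 2 * (2 * R) * |t| < 1 := by linarith
  have dc := hc.hasDerivAt hR h0 h2
  have db := hb.hasDerivAt hR h0 h2
  have dc1 := hc1.hasDerivAt (by positivity) h0 h4'
  have db1 := hb1.hasDerivAt (by positivity) h0 h4'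
  have dl := Real.hasDerivAt_log h0
  have sc := hc.hasSum hR.le h1
  have sb := hb.hasSum hR.le h1
  have sc1 := hc1.hasSum (by positivity) h2
  have sb1 := hb1.hasSum (by positivity) h2
  have sc2 := hc2.hasSum (by positivity) h4'
  have sb2 := hb2.hasSum (by positivity) h4'
  have hp' : HasDerivAt (fun t : ℝ => 1 + p₁ * t + p₂ * t ^ 2) (p₁ + 2 * p₂ * t) t := by
    have := (((hasDerivAt_id t).const_mul p₁).const_add 1).add ((hasDerivAt_pow 2 t).const_mul p₂)
    refine this.congr_deriv ?_
    simp; ring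
  -- This is the equation multiplied by `t`, collected at `log t`; its coefficient at `t ^ (m + 1)`
  -- is the recursion for `c` at `m`, and the constant coefficient vanishes.
  have idC : (1 + p₁ * t + p₂ * t ^ 2) * powerSum (eulerCoeff (eulerCoeff c)) t
      + t * (p₁ + 2 * p₂ * t) * powerSum (eulerCoeff c) t
      + t * (r₀ + r₁ * t) * powerSum c t = 0 := by
    have S1 := hasSum_shiftCoeff sc2
    have S2 := hasSum_shiftCoeff S1
    have S3 := hasSum_shiftCoeff sc1
    have S4 := hasSum_shiftCoeff S3
    have S5 := hasSum_shiftCoeff sc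
    have S6 := hasSum_shiftCoeff S5
    have S := (sc2.add ((S1.mul_left p₁).add (S2.mul_left p₂))).add
      (((S3.mul_left p₁).add (S4.mul_left (2 * p₂))).add ((S5.mul_left r₀).add (S6.mul_left r₁)))
    have key := eq_zero_of_hasSum S fun m => ?_
    · linear_combination key
    · rcases m with _ | _ | m
      · simp [shiftCoeff, eulerCoeff]
      · have := hrc 0
        simp only [shiftCoeff, eulerCoeff] at this ⊢
        push_cast at this ⊢
        linear_combination t * this
      · have := hrc (m + 1)
        simp only [shiftCoeff, eulerCoeff] at this ⊢
        push_cast at this ⊢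
        linear_combination t ^ (m + 2) * this
  -- The part without `log t`. The extra terms in `c` come from differentiating the logarithm; they
  -- are the derivatives in `m` of the recursion's coefficients.
  have idB : (1 + p₁ * t + p₂ * t ^ 2) * (2 * powerSum (eulerCoeff c) t
        + powerSum (eulerCoeff (eulerCoeff b)) t)
      + t * (p₁ + 2 * p₂ * t) * (powerSum c t + powerSum (eulerCoeff b) t)
      + t * (r₀ + r₁ * t) * powerSum b t = 0 := by
    have S1 := hasSum_shiftCoeff sc1
    have S2 := hasSum_shiftCoeff S1
    have S3 := hasSum_shiftCoeff sb2
    have S4 := hasSum_shiftCoeff S3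
    have S5 := hasSum_shiftCoeff sc
    have S6 := hasSum_shiftCoeff S5
    have S7 := hasSum_shiftCoeff sb1
    have S8 := hasSum_shiftCoeff S7
    have S9 := hasSum_shiftCoeff sb
    have S10 := hasSum_shiftCoeff S9
    have S := ((((sc1.add ((S1.mul_left p₁).add (S2.mul_left p₂))).mul_left 2).add
      (sb2.add ((S3.mul_left p₁).add (S4.mul_left p₂)))).add
      (((S5.add S7).mul_left p₁).add ((S6.add S8).mul_left (2 * p₂)))).add
      ((S9.mul_left r₀).add (S10.mul_left r₁))
    have key := eq_zero_of_hasSum S fun m => ?_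
    · linear_combination key
    · rcases m with _ | _ | m
      · simp [shiftCoeff, eulerCoeff]
      · have := hrb 0
        simp only [shiftCoeff, eulerCoeff] at this ⊢
        push_cast at this ⊢
        linear_combination t * this
      · have := hrb (m + 1)
        simp only [shiftCoeff, eulerCoeff] at this ⊢
        push_cast at this ⊢
        linear_combination t ^ (m + 2) * this
  constructor
  · refine ((dc.mul dl).add db).congr_deriv ?_
    have hpt' : 1 + t * p₁ + t ^ 2 * p₂ ≠ 0 := by convert hpt using 1; ring
    field_simp
  · refine (hp'.mul (((dc1.mul dl).add dc).add db1)).congr_deriv ?_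
    simp only [Pi.add_apply, Pi.mul_apply]
    field_simp
    linear_combination (Real.log t) * idC + idB

/-- A solution which tends to zero at `0⁺` vanishes near `0⁺`, provided that there is a solution
tending to `1`. -/
theorem IsFluxPair.eventually_eq_zero {p r y w y₁ w₁ : ℝ → ℝ} {ρ : ℝ} (hρ : 0 < ρ)
    (hp : Tendsto p (𝓝[>] 0) (𝓝 1)) (h : IsFluxPair p r ρ y w) (h₁ : IsFluxPair p r ρ y₁ w₁)
    (hy : Tendsto y (𝓝[>] 0) (𝓝 0)) (hy₁ : Tendsto y₁ (𝓝[>] 0) (𝓝 1)) :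
    ∀ᶠ t in 𝓝[>] (0 : ℝ), y t = 0 := by
  have hpy : Tendsto (fun t => p t * y₁ t ^ 2) (𝓝[>] 0) (𝓝 1) := by
    simpa using hp.mul (hy₁.pow 2)
  have hev : ∀ᶠ t in 𝓝[>] (0 : ℝ), t ∈ Ioo 0 ρ ∧ 0 < p t ∧ 0 < y₁ t ∧ p t * y₁ t ^ 2 < 2 := by
    filter_upwards [Ioo_mem_nhdsGT hρ, hp.eventually (lt_mem_nhds one_pos),
      hy₁.eventually (lt_mem_nhds one_pos), hpy.eventually (gt_mem_nhds one_lt_two)]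
      with t a b c d using ⟨a, b, c, d⟩
  obtain ⟨δ, hδ, hsub⟩ := mem_nhdsGT_iff_exists_Ioo_subset.1 hev
  have hδ : 0 < δ := hδ
  -- The Wronskian, written with fluxes, is constant.
  have hW : ∀ t ∈ Ioo 0 δ, HasDerivAt (fun t => y t * w₁ t - y₁ t * w t) 0 t := fun t ht => by
    obtain ⟨h1, h2, h3, -⟩ := hsub ht
    have := ((h t h1).1.mul (h₁ t h1).2).sub ((h₁ t h1).1.mul (h t h1).2)
    refine this.congr_deriv ?_
    field_simp
    ring
  have hδ2 : δ / 2 ∈ Ioo 0 δ := ⟨by positivity, by linarith⟩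
  obtain ⟨κ, hκ⟩ : ∃ κ, ∀ t ∈ Ioo 0 δ, y t * w₁ t - y₁ t * w t = κ :=
    ⟨_, fun t ht => isOpen_Ioo.is_const_of_deriv_eq_zero isPreconnected_Ioo
      (fun s hs => (hW s hs).differentiableAt.differentiableWithinAt)
      (fun s hs => (hW s hs).deriv) ht hδ2⟩
  have hg : ∀ t ∈ Ioo 0 δ,
      HasDerivAt (fun t => y t / y₁ t) (-κ / (t * (p t * y₁ t ^ 2))) t := fun t ht => by
    obtain ⟨h1, h2, h3, -⟩ := hsub ht
    refine ((h t h1).1.div (h₁ t h1).1 h3.ne').congr_deriv ?_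
    have ht0 : t ≠ 0 := ht.1.ne'
    rw [← hκ t ht]
    field_simp
    ring
  have hg0 : Tendsto (fun t => y t / y₁ t) (𝓝[>] 0) (𝓝 0) := by
    have := hy.div hy₁ one_ne_zero
    rwa [zero_div] at this
  have hκ0 : κ = 0 := by
    by_contra hne
    -- If `κ ≠ 0`, then `y / y₁` behaves like `-κ log t`. Quantitatively, `p y₁² < 2` makes this
    -- auxiliary function decreasing, although it tends to `-∞` at `0⁺`, which is absurd.
    have hF : ∀ t ∈ Ioo 0 δ, HasDerivAt (fun t => κ * (y t / y₁ t) + κ ^ 2 / 2 * Real.log t)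
        (κ * (-κ / (t * (p t * y₁ t ^ 2))) + κ ^ 2 / 2 * t⁻¹) t := fun t ht =>
      ((hg t ht).const_mul κ).add ((Real.hasDerivAt_log ht.1.ne').const_mul _)
    have hanti : AntitoneOn (fun t => κ * (y t / y₁ t) + κ ^ 2 / 2 * Real.log t) (Ioo 0 δ) := by
      refine antitoneOn_of_deriv_nonpos (convex_Ioo _ _)
        (fun t ht => (hF t ht).continuousAt.continuousWithinAt) ?_ ?_
      · rw [interior_Ioo]
        exact fun t ht => (hF t ht).differentiableAt.differentiableWithinAt
      · rw [interior_Ioo]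
        intro t ht
        rw [(hF t ht).deriv]
        obtain ⟨h1, h2, h3, h4⟩ := hsub ht
        have ht0 := ht.1
        have hpos : 0 < p t * y₁ t ^ 2 := by positivity
        have e : κ * (-κ / (t * (p t * y₁ t ^ 2))) + κ ^ 2 / 2 * t⁻¹
            = -(κ ^ 2 / t * ((p t * y₁ t ^ 2)⁻¹ - 2⁻¹)) := by field_simp; ring
        rw [e, neg_nonpos]
        exact mul_nonneg (by positivity) (sub_nonneg.2 (inv_anti₀ hpos h4.le))
    have hbot : Tendsto (fun t => κ * (y t / y₁ t) + κ ^ 2 / 2 * Real.log t) (𝓝[>] 0) atBot := by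
      refine Tendsto.add_atBot (hg0.const_mul κ) ?_
      exact Real.tendsto_log_nhdsGT_zero.const_mul_atBot (by positivity)
    obtain ⟨t, ht, ht1, ht2⟩ := ((hbot.eventually_lt_atBot
      (κ * (y (δ / 2) / y₁ (δ / 2)) + κ ^ 2 / 2 * Real.log (δ / 2))).and
      (Ioo_mem_nhdsGT hδ2.1)).exists
    exact absurd (hanti ⟨ht1, ht2.trans hδ2.2⟩ hδ2 ht2.le) (not_le.2 ht)
  have hconst : ∀ t ∈ Ioo 0 δ, y t / y₁ t = y (δ / 2) / y₁ (δ / 2) := fun t ht =>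
    isOpen_Ioo.is_const_of_deriv_eq_zero isPreconnected_Ioo
      (fun s hs => (hg s hs).differentiableAt.differentiableWithinAt)
      (fun s hs => by rw [(hg s hs).deriv, hκ0]; simp) ht hδ2
  have hz : y (δ / 2) / y₁ (δ / 2) = 0 := by
    refine tendsto_nhds_unique (tendsto_const_nhds.congr' ?_) hg0
    filter_upwards [Ioo_mem_nhdsGT hδ] with t ht using (hconst t ht).symm
  filter_upwards [Ioo_mem_nhdsGT hδ] with t ht
  have := (hconst t ht).trans hz
  exact (div_eq_zero_iff.1 this).resolve_right (hsub ht).2.2.1.ne'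

theorem IsFluxPair.linear_combination {p r y w y₁ w₁ : ℝ → ℝ} {ρ : ℝ}
    (h : IsFluxPair p r ρ y w) (h₁ : IsFluxPair p r ρ y₁ w₁) (κ : ℝ) :
    IsFluxPair p r ρ (fun t => y t + κ * y₁ t) (fun t => w t + κ * w₁ t) := fun t ht => by
  refine ⟨((h t ht).1.add ((h₁ t ht).1.const_mul κ)).congr_deriv ?_,
    ((h t ht).2.add ((h₁ t ht).2.const_mul κ)).congr_deriv ?_⟩ <;> ring

/-! ### Recursions for the coefficients of the double series -/

/-- The factor `(k + s)²` is exactly what the recursion of `u` converts into the previous term. The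
boundary term `k = 0` drops out because `s² = 0`. -/
theorem sum_antidiagonal_sq_mul {K : Type*} [CommRing K] {s h : K} (hs : s ^ 2 = 0) {u : ℕ → K}
    (hu : ∀ k : ℕ, (k + 1 + s) ^ 2 * u (k + 1) = (k + s + h) * u k) (f : ℕ → ℕ → K) (m : ℕ) :
    ∑ p ∈ Finset.HasAntidiagonal.antidiagonal (m + 1), (p.1 + s) ^ 2 * f p.1 p.2 * (u p.1 * u p.2)
      = ∑ p ∈ Finset.HasAntidiagonal.antidiagonal m, (p.1 + s + h) * f (p.1 + 1) p.2 * (u p.1 * u p.2) := by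
  rw [Finset.Nat.sum_antidiagonal_succ]
  simp only [Nat.cast_zero, zero_add, hs, zero_mul]
  refine Finset.sum_congr rfl fun p _ => ?_
  push_cast
  linear_combination f (p.1 + 1) p.2 * u p.2 * hu p.1

theorem sum_antidiagonal_sq_mul' {K : Type*} [CommRing K] {s h : K} (hs : s ^ 2 = 0) {u : ℕ → K}
    (hu : ∀ k : ℕ, (k + 1 + s) ^ 2 * u (k + 1) = (k + s + h) * u k) (f : ℕ → ℕ → K) (m : ℕ) :
    ∑ p ∈ Finset.HasAntidiagonal.antidiagonal (m + 1), (p.2 + s) ^ 2 * f p.1 p.2 * (u p.1 * u p.2)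
      = ∑ p ∈ Finset.HasAntidiagonal.antidiagonal m, (p.2 + s + h) * f p.1 (p.2 + 1) * (u p.1 * u p.2) := by
  have := sum_antidiagonal_sq_mul hs hu (fun k l => f l k) m
  rw [← Finset.Nat.sum_antidiagonal_swap, ← Finset.Nat.sum_antidiagonal_swap (n := m)] at this
  simpa [mul_comm (u _) (u _)] using this

/-- The convolution square of a hypergeometric sequence `(k+1+s)² u (k+1) = (k+s+1/2) u k`, `s² = 0`,
satisfies a three-term recursion. -/
theorem antidiagonal_recurrence {K : Type*} [CommRing K] {s h : K} (hs : s ^ 2 = 0)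
    (hh : 2 * h = 1) {u a : ℕ → K}
    (hu : ∀ k : ℕ, (k + 1 + s) ^ 2 * u (k + 1) = (k + s + h) * u k)
    (ha : ∀ m, a m = ∑ p ∈ Finset.HasAntidiagonal.antidiagonal m, u p.1 * u p.2) (m : ℕ) :
    (m + 2 * s + 1) ^ 3 * a (m + 1) - (3 * (m + 2 * s) ^ 2 + 3 * (m + 2 * s) + 1) * a m
      + 2 * (m + 2 * s) * shiftCoeff a m = 0 := by
  -- With `K = k + s`, `L = l + s` one has `(K + L)³ = K² (K + 3L) + L² (L + 3K)`, so every summand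
  -- carries a square that lowers an index.
  have h1 : (m + 2 * s + 1) ^ 3 * a (m + 1)
      = ∑ p ∈ Finset.HasAntidiagonal.antidiagonal m, ((p.1 + s + h) * ((p.1 + s + 1) + 3 * (p.2 + s))
        + (p.2 + s + h) * ((p.2 + s + 1) + 3 * (p.1 + s))) * (u p.1 * u p.2) := by
    have e1 := sum_antidiagonal_sq_mul hs hu (fun k l => (k + s) + 3 * (l + s)) m
    have e2 := sum_antidiagonal_sq_mul' hs hu (fun k l => (l + s) + 3 * (k + s)) m
    simp only [add_mul _ _ (u _ * u _), Finset.sum_add_distrib]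
    push_cast at e1 e2
    have e3 : ∀ k : ℕ, (k : K) + s + 1 = k + 1 + s := fun k => by ring
    simp only [e3]
    rw [← e1, ← e2, ← Finset.sum_add_distrib, ha, Finset.mul_sum]
    refine Finset.sum_congr rfl fun p hp => ?_
    have hp : ((p.1 : K) + p.2) = m + 1 := by
      exact_mod_cast congrArg (Nat.cast (R := K)) (Finset.HasAntidiagonal.mem_antidiagonal.1 hp)
    rw [show (m : K) + 2 * s + 1 = (p.1 + s) + (p.2 + s) by linear_combination -hp]
    ring
  -- For `K + L = m + 2s` the quadratic coefficient is chosen so that only `-2 (K² + L²)` survives,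
  -- and these squares lower an index once more.
  have h2 : (m + 2 * s + 1) ^ 3 * a (m + 1)
      - (3 * (m + 2 * s) ^ 2 + 3 * (m + 2 * s) + 1) * a m
      = -2 * (∑ p ∈ Finset.HasAntidiagonal.antidiagonal m, (p.1 + s) ^ 2 * 1 * (u p.1 * u p.2)
        + ∑ p ∈ Finset.HasAntidiagonal.antidiagonal m, (p.2 + s) ^ 2 * 1 * (u p.1 * u p.2)) := by
    rw [h1, ha, Finset.mul_sum, ← Finset.sum_sub_distrib, ← Finset.sum_add_distrib,
      Finset.mul_sum]
    refine Finset.sum_congr rfl fun p hp => ?_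
    have hp : ((p.1 : K) + p.2) = m := by
      exact_mod_cast congrArg (Nat.cast (R := K)) (Finset.HasAntidiagonal.mem_antidiagonal.1 hp)
    rw [show (m : K) + 2 * s = (p.1 + s) + (p.2 + s) by linear_combination -hp]
    linear_combination (2 * (p.1 + s) + 2 * (p.2 + s) + 1) * (u p.1 * u p.2) * hh
  rw [h2]
  rcases m with _ | m
  · simp [shiftCoeff, hs]
  · have e1 := sum_antidiagonal_sq_mul hs hu (fun _ _ => 1) m
    have e2 := sum_antidiagonal_sq_mul' hs hu (fun _ _ => 1) m
    rw [e1, e2, shiftCoeff, ha, ← Finset.sum_add_distrib, Finset.mul_sum, Finset.mul_sum,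
      ← Finset.sum_add_distrib]
    refine Finset.sum_eq_zero fun p hp => ?_
    have hp : ((p.1 : K) + p.2) = m := by
      exact_mod_cast congrArg (Nat.cast (R := K)) (Finset.HasAntidiagonal.mem_antidiagonal.1 hp)
    push_cast
    linear_combination (-2 * u p.1 * u p.2) * hp - (2 * u p.1 * u p.2) * hh

/-- The factorial-type factor `F` reduces the cube of the leading coefficient to a square and the
sign adjusts the middle term. What results is the Frobenius recursion with `p₁ = 3`, `p₂ = 2`, `r₀ =
1`, `r₁ = 2`, at the shifted index `m + 2s`. -/
theorem signed_recurrence {K : Type*} [CommRing K] {s h : K} (hs : s ^ 2 = 0)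
    (hh : 2 * h = 1) {u F C : ℕ → K}
    (hu : ∀ k : ℕ, (k + 1 + s) ^ 2 * u (k + 1) = (k + s + h) * u k)
    (hF : ∀ m : ℕ, F (m + 1) = (m + 2 * s + 1) * F m)
    (hC : ∀ m, C m = (-1) ^ m * (F m * ∑ p ∈ Finset.HasAntidiagonal.antidiagonal m, u p.1 * u p.2)) (m : ℕ) :
    (m + 2 * s + 1) ^ 2 * C (m + 1) + (3 * ((m + 2 * s) * (m + 2 * s + 1)) + 1) * C m
      + (2 * ((m + 2 * s) ^ 2 - 1) + 2) * shiftCoeff C m = 0 := by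
  have key := antidiagonal_recurrence hs hh hu (fun m => rfl) m
  rcases m with _ | m
  · simp only [shiftCoeff, hC, hF] at key ⊢
    linear_combination -F 0 * key
  · simp only [shiftCoeff, hC] at key ⊢
    rw [hF (m + 1)]
    have := hF m
    push_cast at *
    linear_combination (-1) ^ m * F (m + 1) * key - (-1) ^ m * (2 * (m + 1 + 2 * s)) *
      (∑ p ∈ Finset.HasAntidiagonal.antidiagonal m, u p.1 * u p.2) * this

/-! ### The digamma function -/

theorem psi_add_one {x : ℝ} (hx : ∀ m : ℕ, x ≠ -m) : psi (x + 1) = psi x + 1 / x := by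
  have hx0 : x ≠ 0 := by simpa using hx 0
  have h1 : ∀ m : ℕ, x + 1 ≠ -m := fun m h => hx (m + 1) (by push_cast; linarith)
  have d1 := (Real.differentiableAt_Gamma h1).hasDerivAt
  have d0 := (Real.differentiableAt_Gamma hx).hasDerivAt
  have e : (fun y => Real.Gamma (y + 1)) =ᶠ[𝓝 x] fun y => y * Real.Gamma y := by
    filter_upwards [isOpen_ne.mem_nhds hx0] with y hy using Real.Gamma_add_one hy
  have d2 := ((hasDerivAt_id x).mul d0).congr_of_eventuallyEq e
  have d3 := (d1.comp_add_const x 1).unique d2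
  have hG : Real.Gamma x ≠ 0 := Real.Gamma_ne_zero hx
  rw [psi, psi, Real.Gamma_add_one hx0, d3]
  simp only [id]
  field_simp
  ring

theorem psi_nat_add_one (n : ℕ) : psi ((n + 1 : ℕ) + 1) = psi ((n : ℝ) + 1) + 1 / (n + 1) := by
  push_cast
  exact psi_add_one fun m h => by
    have : (0 : ℝ) ≤ m := Nat.cast_nonneg m
    have : (0 : ℝ) ≤ n := Nat.cast_nonneg n
    linarith

theorem psi_nat_add_half (n : ℕ) :
    psi ((n + 1 : ℕ) + 1 / 2) = psi ((n : ℝ) + 1 / 2) + 1 / (n + 1 / 2) := by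
  rw [← psi_add_one]
  · push_cast; ring_nf
  · intro m h
    have : (0 : ℝ) ≤ m := Nat.cast_nonneg m
    have : (0 : ℝ) ≤ n := Nat.cast_nonneg n
    linarith

theorem half_sub_nat_ne_neg_nat (n m : ℕ) : (1 / 2 : ℝ) - n ≠ -m := by
  intro h
  have h2 : (1 : ℝ) + 2 * m = 2 * n := by linarith
  have h3 : 1 + 2 * m = 2 * n := by exact_mod_cast h2
  omega

/-- The functional equation moves both sides in step: passing from `n` to `n + 1` adds `1 / (n +
1/2)` to each. -/
theorem psi_half_sub_nat (n : ℕ) : psi (1 / 2 - n) = psi ((n : ℝ) + 1 / 2) := by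
  induction n with
  | zero => simp
  | succ n ih =>
    have h := psi_add_one (half_sub_nat_ne_neg_nat (n + 1))
    rw [psi_nat_add_half, ← ih]
    have e : (1 / 2 : ℝ) - (n + 1 : ℕ) + 1 = 1 / 2 - n := by push_cast; ring
    rw [e] at h
    have h0 : (n : ℝ) + 1 / 2 ≠ 0 := by positivity
    have e2 : 1 / ((1 / 2 : ℝ) - (n + 1 : ℕ)) = -(1 / (n + 1 / 2)) := by
      rw [← one_div_neg_eq_neg_one_div]; push_cast; ring_nf
    rw [e2] at h
    linarith

theorem psi_half_sub_psi_one : psi (1 / 2) - psi 1 = -2 * Real.log 2 := by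
  rw [psi, psi, Real.hasDerivAt_Gamma_one_half.deriv, Real.hasDerivAt_Gamma_one.deriv,
    Real.Gamma_one, Real.Gamma_one_half_eq]
  have : √Real.pi ≠ 0 := by positivity
  field_simp
  ring

/-! ### Coefficients of the double series as dual numbers -/

/-- The coefficients `Γ(k + 1/2) / (√π Γ(k + 1)²)`. -/
noncomputable def halfCoeff (k : ℕ) : ℝ :=
  Real.Gamma (k + 1 / 2) / (√Real.pi * Real.Gamma (k + 1) ^ 2)

/-- Half the logarithmic derivative of `halfCoeff` in `k`. -/
noncomputable def halfLog (k : ℕ) : ℝ :=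
  psi (k + 1 / 2) / 2 - psi (k + 1)

theorem halfCoeff_succ (k : ℕ) :
    (k + 1 : ℝ) ^ 2 * halfCoeff (k + 1) = (k + 1 / 2) * halfCoeff k := by
  have h0 : (k : ℝ) + 1 / 2 ≠ 0 := by positivity
  have h1 : (k : ℝ) + 1 ≠ 0 := by positivity
  have hg : Real.Gamma ((k : ℝ) + 1) ≠ 0 := (Real.Gamma_pos_of_pos (by positivity)).ne'
  have hpi : √Real.pi ≠ 0 := by positivity
  rw [halfCoeff, halfCoeff]
  push_cast
  rw [show (k : ℝ) + 1 + 1 / 2 = k + 1 / 2 + 1 by ring, Real.Gamma_add_one h0,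
    Real.Gamma_add_one h1]
  field_simp

theorem halfLog_succ (k : ℕ) :
    halfLog (k + 1) = halfLog k + 1 / (2 * (k + 1 / 2)) - 1 / (k + 1) := by
  rw [halfLog, halfLog, psi_nat_add_one, psi_nat_add_half]
  field_simp
  ring

/-- The coefficient of `x ^ (k + l) * log x` in half the `(k,l)`-term of the expansion. -/
noncomputable def pairCoeff (k l : ℕ) : ℝ :=
  (-1) ^ (k + l) * (Real.Gamma ((k + l : ℕ) + 1) * (halfCoeff k * halfCoeff l))

/-- The coefficient of `x ^ (k + l)` in half the `(k,l)`-term of the expansion. -/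
noncomputable def pairLogCoeff (k l : ℕ) : ℝ :=
  pairCoeff k l * (psi ((k + l : ℕ) + 1) + halfLog k + halfLog l)

theorem inv_Gamma_half_sub_nat (l : ℕ) :
    (Real.Gamma (1 / 2 - l))⁻¹ = (-1) ^ l * Real.Gamma (l + 1 / 2) / Real.pi := by
  have h := Real.Gamma_mul_Gamma_one_sub ((l : ℝ) + 1 / 2)
  have hs : Real.sin (Real.pi * (l + 1 / 2)) = (-1) ^ l := by
    rw [show Real.pi * ((l : ℝ) + 1 / 2) = l * Real.pi + Real.pi / 2 by ring,
      Real.sin_add_pi_div_two, Real.cos_nat_mul_pi]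
  rw [hs, show (1 : ℝ) - (l + 1 / 2) = 1 / 2 - l by ring] at h
  have h0 : Real.Gamma (1 / 2 - (l : ℝ)) ≠ 0 :=
    Real.Gamma_ne_zero fun m => half_sub_nat_ne_neg_nat l m
  have h2 : ((-1 : ℝ) ^ l) ≠ 0 := pow_ne_zero _ (by norm_num)
  rw [eq_div_iff h2] at h
  rw [inv_eq_one_div, div_eq_div_iff h0 Real.pi_ne_zero]
  linear_combination -h

/-- The reflection formula turns `1 / Γ(1/2 - l)` into `(-1)^l Γ(l + 1/2) / π`, which makes the term
symmetric in `k` and `l`. The digamma terms become twice the logarithmic derivative attached to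
`pairCoeff`. -/
theorem A_neg_one_add (k l : ℕ) (x : ℝ) :
    A k l (-x) (1 + x)
      = 2 * (x ^ (k + l) * (pairCoeff k l * Real.log x + pairLogCoeff k l)) := by
  have hpi : √Real.pi ^ 2 = Real.pi := Real.sq_sqrt Real.pi_pos.le
  have hpi0 : √Real.pi ≠ 0 := by positivity
  have e : Real.Gamma ((k : ℝ) + 1 / 2) * Real.Gamma ((k : ℝ) + (l : ℝ) + 1) /
      (Real.Gamma ((k : ℝ) + 1) ^ 2 * Real.Gamma (1 / 2 - (l : ℝ)) *
        Real.Gamma ((l : ℝ) + 1) ^ 2)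
      = Real.Gamma ((k + l : ℕ) + 1) * (halfCoeff k * ((-1) ^ l * halfCoeff l)) := by
    have hg : Real.Gamma ((k : ℝ) + 1) ≠ 0 := (Real.Gamma_pos_of_pos (by positivity)).ne'
    have hg' : Real.Gamma ((l : ℝ) + 1) ≠ 0 := (Real.Gamma_pos_of_pos (by positivity)).ne'
    calc _ = Real.Gamma ((k : ℝ) + 1 / 2) * Real.Gamma ((k : ℝ) + (l : ℝ) + 1) /
          (Real.Gamma ((k : ℝ) + 1) ^ 2 * Real.Gamma ((l : ℝ) + 1) ^ 2)
            * (Real.Gamma (1 / 2 - (l : ℝ)))⁻¹ := by rw [← div_eq_mul_inv, div_div]; ring_nf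
      _ = _ := by
        rw [inv_Gamma_half_sub_nat, ← hpi, halfCoeff, halfCoeff]
        push_cast
        field_simp
  rw [A, e, neg_neg, add_sub_cancel_left, psi_half_sub_nat, pairLogCoeff, pairCoeff, halfLog,
    halfLog, neg_pow, pow_add, pow_add]
  push_cast
  ring

/-- The coefficients of the logarithmic part of the double series, collected by degree. -/
noncomputable def diagCoeff (m : ℕ) : ℝ :=
  ∑ p ∈ Finset.HasAntidiagonal.antidiagonal m, pairCoeff p.1 p.2

/-- The coefficients of the regular part of the double series, collected by degree. -/
noncomputable def diagLogCoeff (m : ℕ) : ℝ :=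
  ∑ p ∈ Finset.HasAntidiagonal.antidiagonal m, pairLogCoeff p.1 p.2

/-- `halfCoeff` with its parameter derivative, as a dual number. -/
noncomputable def dualHalfCoeff (k : ℕ) : DualNumber ℝ :=
  TrivSqZeroExt.inl (halfCoeff k) + TrivSqZeroExt.inr (halfCoeff k * halfLog k)

/-- The factorial with its parameter derivative, as a dual number. -/
noncomputable def dualFactorial (m : ℕ) : DualNumber ℝ :=
  TrivSqZeroExt.inl (Real.Gamma (m + 1))
    + TrivSqZeroExt.inr (Real.Gamma (m + 1) * psi (m + 1))

/-- `diagCoeff` with its parameter derivative, as a dual number. -/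
noncomputable def dualDiagCoeff (m : ℕ) : DualNumber ℝ :=
  (-1) ^ m * (dualFactorial m *
    ∑ p ∈ Finset.HasAntidiagonal.antidiagonal m, dualHalfCoeff p.1 * dualHalfCoeff p.2)

/-- The product rule is built into dual multiplication: the infinitesimal parts of the three factors
add up to the bracket in `pairLogCoeff`. -/
theorem dualDiagCoeff_eq (m : ℕ) : dualDiagCoeff m
    = TrivSqZeroExt.inl (diagCoeff m) + TrivSqZeroExt.inr (diagLogCoeff m) := by
  have e : ((-1 : DualNumber ℝ) ^ m) = TrivSqZeroExt.inl ((-1) ^ m) := by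
    rw [← TrivSqZeroExt.inl_pow]; simp
  rw [dualDiagCoeff, e]
  ext
  · simp only [TrivSqZeroExt.fst_mul, TrivSqZeroExt.fst_add, TrivSqZeroExt.fst_inl,
      TrivSqZeroExt.fst_inr, TrivSqZeroExt.fst_sum, dualFactorial, dualHalfCoeff, diagCoeff,
      pairCoeff, add_zero, Finset.mul_sum]
    refine Finset.sum_congr rfl fun p hp => ?_
    rw [Finset.HasAntidiagonal.mem_antidiagonal.1 hp]
  · simp only [TrivSqZeroExt.fst_mul, TrivSqZeroExt.fst_add, TrivSqZeroExt.fst_inl,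
      TrivSqZeroExt.fst_inr, dualFactorial, dualHalfCoeff, diagLogCoeff,
      pairCoeff, pairLogCoeff, add_zero, Finset.mul_sum, DualNumber.snd_mul,
      TrivSqZeroExt.snd_add, TrivSqZeroExt.snd_inl, TrivSqZeroExt.snd_inr, zero_add,
      TrivSqZeroExt.snd_sum, zero_mul]
    refine Finset.sum_congr rfl fun p hp => ?_
    rw [Finset.HasAntidiagonal.mem_antidiagonal.1 hp]
    ring

/-- The infinitesimal by which the indices of the coefficients are shifted. -/
noncomputable def dualShift : DualNumber ℝ :=
  TrivSqZeroExt.inr (1 / 2)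

theorem dualNumber_two : (2 : DualNumber ℝ) = TrivSqZeroExt.inl 2 :=
  (map_ofNat (TrivSqZeroExt.inlHom ℝ ℝ) 2).symm

theorem dualNumber_three : (3 : DualNumber ℝ) = TrivSqZeroExt.inl 3 :=
  (map_ofNat (TrivSqZeroExt.inlHom ℝ ℝ) 3).symm

/-- Each index of `halfCoeff` is shifted by half an infinitesimal, so the degree `m` is shifted by a
full one. The real part of this identity is the recursion for `diagCoeff`; the infinitesimal part is
that for `diagLogCoeff`, with the `m`-derivatives of the polynomial coefficients as inhomogeneity.
-/
theorem dualDiagCoeff_recurrence (m : ℕ) :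
    ((m : DualNumber ℝ) + 2 * dualShift + 1) ^ 2 * dualDiagCoeff (m + 1)
      + (3 * (((m : DualNumber ℝ) + 2 * dualShift) * ((m : DualNumber ℝ) + 2 * dualShift + 1)) + 1)
        * dualDiagCoeff m
      + (2 * (((m : DualNumber ℝ) + 2 * dualShift) ^ 2 - 1) + 2) * shiftCoeff dualDiagCoeff m
      = 0 := by
  refine signed_recurrence (h := TrivSqZeroExt.inl (1 / 2)) (u := dualHalfCoeff)
    (F := dualFactorial) ?_ ?_ (fun k => ?_) (fun k => ?_) (fun k => rfl) m
  · rw [sq, dualShift, TrivSqZeroExt.inr_mul_inr]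
  · ext <;> simp [dualNumber_two]
  · have h1 := halfCoeff_succ k
    have h2 := halfLog_succ k
    have hk : (k : ℝ) + 1 / 2 ≠ 0 := by positivity
    have hk' : (k : ℝ) + 1 ≠ 0 := by positivity
    ext
    · simp [sq, dualShift, dualHalfCoeff]
      linear_combination h1
    · simp [sq, dualShift, dualHalfCoeff]
      have hA : ((k : ℝ) + 1 / 2) * (1 / (2 * (k + 1 / 2))) = 1 / 2 := by field_simp
      have hB : ((k : ℝ) + 1) * (1 / (k + 1)) = 1 := by field_simp
      linear_combination (halfLog (k + 1) + 1 / ((k : ℝ) + 1)) * h1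
        + ((k : ℝ) + 1 / 2) * halfCoeff k * h2 + halfCoeff k * hA
        - ((k : ℝ) + 1) * halfCoeff (k + 1) * hB
  · have hk' : (k : ℝ) + 1 ≠ 0 := by positivity
    ext
    · simp [dualShift, dualFactorial, dualNumber_two, Real.Gamma_add_one hk']
    · simp [dualShift, dualFactorial, dualNumber_two, Real.Gamma_add_one hk']
      have h := psi_nat_add_one k
      push_cast at h
      rw [h]
      field_simp

theorem diagCoeff_recurrence (m : ℕ) :
    (m + 1 : ℝ) ^ 2 * diagCoeff (m + 1) + (3 * (m * (m + 1)) + 1) * diagCoeff m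
      + (2 * (m ^ 2 - 1) + 2) * shiftCoeff diagCoeff m = 0 := by
  have h := congrArg TrivSqZeroExt.fst (dualDiagCoeff_recurrence m)
  rcases m with _ | m
  · simp [shiftCoeff, dualDiagCoeff_eq, dualShift, sq, dualNumber_two, dualNumber_three] at h ⊢
    linear_combination h
  · simp [shiftCoeff, dualDiagCoeff_eq, dualShift, sq, dualNumber_two, dualNumber_three] at h ⊢
    linear_combination h

theorem diagLogCoeff_recurrence (m : ℕ) :
    (m + 1 : ℝ) ^ 2 * diagLogCoeff (m + 1) + (3 * (m * (m + 1)) + 1) * diagLogCoeff m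
      + (2 * (m ^ 2 - 1) + 2) * shiftCoeff diagLogCoeff m
      + (2 * (m + 1) * diagCoeff (m + 1) + 3 * (2 * m + 1) * diagCoeff m
        + 2 * 2 * m * shiftCoeff diagCoeff m) = 0 := by
  have h := congrArg TrivSqZeroExt.snd (dualDiagCoeff_recurrence m)
  rcases m with _ | m
  · simp [shiftCoeff, dualDiagCoeff_eq, dualShift, sq, dualNumber_two, dualNumber_three] at h ⊢
    linear_combination h
  · simp [shiftCoeff, dualDiagCoeff_eq, dualShift, sq, dualNumber_two, dualNumber_three] at h ⊢
    linear_combination h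

theorem diagCoeff_zero : diagCoeff 0 = 1 := by
  have : √Real.pi ≠ 0 := by positivity
  have h : Real.Gamma 2⁻¹ = √Real.pi := by rw [← one_div, Real.Gamma_one_half_eq]
  simp [diagCoeff, pairCoeff, halfCoeff, h, this]

theorem diagLogCoeff_zero : diagLogCoeff 0 = -2 * Real.log 2 := by
  have h : pairCoeff 0 0 = 1 := by simpa [diagCoeff] using diagCoeff_zero
  have := psi_half_sub_psi_one
  simp only [diagLogCoeff, pairLogCoeff, Finset.Nat.antidiagonal_zero, Finset.sum_singleton, h, halfLog]
  simp only [Nat.cast_zero, zero_add, add_zero]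
  linarith

/-! ### An elliptic integral -/

/-- Differentiation under an interval integral with continuous derivative. -/
theorem hasDerivAt_intervalIntegral {F F' : ℝ → ℝ → ℝ} {U : Set ℝ} (hU : IsOpen U) {a b x₀ : ℝ}
    (hx₀ : x₀ ∈ U) (hF : ∀ x ∈ U, Continuous (F x))
    (hF' : ContinuousOn (fun q : ℝ × ℝ => F' q.1 q.2) (U ×ˢ univ))
    (h : ∀ x ∈ U, ∀ t, HasDerivAt (fun y => F y t) (F' x t) x) :
    HasDerivAt (fun x => ∫ t in a..b, F x t) (∫ t in a..b, F' x₀ t) x₀ := by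
  obtain ⟨δ, hδ, hsub⟩ := Metric.nhds_basis_closedBall.mem_iff.1 (hU.mem_nhds hx₀)
  have hK : IsCompact (Metric.closedBall x₀ δ ×ˢ uIcc a b) :=
    (isCompact_closedBall _ _).prod isCompact_uIcc
  obtain ⟨C, hC⟩ := hK.exists_bound_of_continuousOn
    (hF'.mono (prod_mono hsub (subset_univ _)))
  have hF'x : Continuous (F' x₀) := by
    rw [← continuousOn_univ]
    exact hF'.comp (f := fun t => (x₀, t)) (by fun_prop) fun t _ => ⟨hx₀, mem_univ _⟩
  refine (intervalIntegral.hasDerivAt_integral_of_dominated_loc_of_deriv_le (F := F) (F' := F')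
    (bound := fun _ => C) (Metric.closedBall_mem_nhds x₀ hδ) ?_
    ((hF x₀ hx₀).intervalIntegrable _ _) hF'x.aestronglyMeasurable ?_
    intervalIntegrable_const ?_).2
  · filter_upwards [hU.mem_nhds hx₀] with x hx using (hF x hx).aestronglyMeasurable
  · exact Eventually.of_forall fun t ht x hx => hC (x, t) ⟨hx, uIoc_subset_uIcc ht⟩
  · exact Eventually.of_forall fun t ht x hx => h x (hsub hx) t

/-- The kernel `(z + sin² t)^(-1/2)`. -/
noncomputable def ellKernel (z t : ℝ) : ℝ :=
  (√(z + Real.sin t ^ 2))⁻¹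

/-- The elliptic integral `∫₀^{π/2} (z + sin² t)^(-1/2) dt`. -/
noncomputable def ellInt (z : ℝ) : ℝ :=
  ∫ t in (0 : ℝ)..(Real.pi / 2), ellKernel z t

/-- The derivative of `ellInt`. -/
noncomputable def ellIntDeriv (z : ℝ) : ℝ :=
  ∫ t in (0 : ℝ)..(Real.pi / 2), -(1 / 2) * ellKernel z t ^ 3

theorem ellKernel_sq_mul {z : ℝ} (hz : 0 < z) (t : ℝ) :
    ellKernel z t ^ 2 * (z + Real.sin t ^ 2) = 1 := by
  have h : 0 < z + Real.sin t ^ 2 := by positivity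
  rw [ellKernel, inv_pow, Real.sq_sqrt h.le]
  field_simp

theorem continuousOn_ellKernel :
    ContinuousOn (fun q : ℝ × ℝ => ellKernel q.1 q.2) (Ioi 0 ×ˢ univ) := by
  unfold ellKernel
  refine ContinuousOn.inv₀ (by fun_prop) fun q hq => ?_
  have : 0 < q.1 := hq.1
  positivity

theorem continuous_ellKernel {z : ℝ} (hz : 0 < z) : Continuous (ellKernel z) := by
  rw [← continuousOn_univ]
  exact continuousOn_ellKernel.comp (f := fun t => (z, t)) (by fun_prop) fun t _ =>
    ⟨hz, mem_univ _⟩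

theorem hasDerivAt_ellKernel {z : ℝ} (hz : 0 < z) (t : ℝ) :
    HasDerivAt (fun y => ellKernel y t) (-(1 / 2) * ellKernel z t ^ 3) z := by
  have h : 0 < z + Real.sin t ^ 2 := by positivity
  have h1 := (((hasDerivAt_id z).add_const (Real.sin t ^ 2)).sqrt h.ne').inv
    (Real.sqrt_pos.2 h).ne'
  refine h1.congr_deriv ?_
  have : √(z + Real.sin t ^ 2) ≠ 0 := (Real.sqrt_pos.2 h).ne'
  rw [ellKernel]
  simp only [id]
  field_simp

theorem hasDerivAt_ellKernel_angle {z : ℝ} (hz : 0 < z) (t : ℝ) :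
    HasDerivAt (ellKernel z) (-(Real.sin t * Real.cos t) * ellKernel z t ^ 3) t := by
  have h : 0 < z + Real.sin t ^ 2 := by positivity
  have h1 := ((((Real.hasDerivAt_sin t).pow 2).const_add z).sqrt h.ne').inv
    (Real.sqrt_pos.2 h).ne'
  refine h1.congr_deriv ?_
  have : √(z + Real.sin t ^ 2) ≠ 0 := (Real.sqrt_pos.2 h).ne'
  rw [ellKernel]
  simp only [Pi.pow_apply]
  field_simp
  ring

theorem hasDerivAt_ellInt {z : ℝ} (hz : 0 < z) : HasDerivAt ellInt (ellIntDeriv z) z :=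
  hasDerivAt_intervalIntegral isOpen_Ioi (mem_Ioi.2 hz) (fun _ hx => continuous_ellKernel hx)
    (continuousOn_const.mul (continuousOn_ellKernel.pow 3)) fun _ hx t => hasDerivAt_ellKernel hx t

theorem hasDerivAt_ellIntDeriv {z : ℝ} (hz : 0 < z) : HasDerivAt ellIntDeriv
    (∫ t in (0 : ℝ)..(Real.pi / 2), 3 / 4 * ellKernel z t ^ 5) z := by
  refine hasDerivAt_intervalIntegral (F := fun z t => -(1 / 2) * ellKernel z t ^ 3)
    (F' := fun z t => 3 / 4 * ellKernel z t ^ 5) isOpen_Ioi (mem_Ioi.2 hz)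
    (fun _ hx => continuous_const.mul ((continuous_ellKernel hx).pow 3))
    (continuousOn_const.mul (continuousOn_ellKernel.pow 5)) fun x hx t => ?_
  refine (((hasDerivAt_ellKernel hx t).pow 3).const_mul (-(1 / 2))).congr_deriv ?_
  simp
  ring

/-- Legendre's equation `(z (1 + z) T')' = -T / 4` for `ellInt`. -/
theorem ellInt_legendre {z : ℝ} (hz : 0 < z) :
    HasDerivAt (fun z => z * (1 + z) * ellIntDeriv z) (-(1 / 4) * ellInt z) z := by
  have hd := ((hasDerivAt_id z).mul ((hasDerivAt_id z).const_add 1)).mul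
    (hasDerivAt_ellIntDeriv hz)
  refine hd.congr_deriv ?_
  have hk := continuous_ellKernel hz
  -- The integrand is the derivative of `sin t cos t (z + sin² t)^(-3/2)`, which vanishes at both
  -- endpoints. Expressed through powers of the kernel it is four times Legendre's equation under
  -- the integral.
  have key : ∫ t in (0 : ℝ)..(Real.pi / 2), ((Real.cos t ^ 2 - Real.sin t ^ 2) * ellKernel z t ^ 3
      - 3 * Real.sin t ^ 2 * Real.cos t ^ 2 * ellKernel z t ^ 5) = 0 := by
    rw [intervalIntegral.integral_eq_sub_of_hasDerivAt
      (f := fun t => Real.sin t * Real.cos t * ellKernel z t ^ 3)]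
    · simp
    · intro t _
      refine (((Real.hasDerivAt_sin t).mul (Real.hasDerivAt_cos t)).mul
        ((hasDerivAt_ellKernel_angle hz t).pow 3)).congr_deriv ?_
      simp only [Pi.mul_apply, Pi.pow_apply]
      push_cast
      ring
    · exact Continuous.intervalIntegrable (by fun_prop) _ _
  have e : ∀ t, (Real.cos t ^ 2 - Real.sin t ^ 2) * ellKernel z t ^ 3
      - 3 * Real.sin t ^ 2 * Real.cos t ^ 2 * ellKernel z t ^ 5
      = 4 * (1 + 2 * z) * (-(1 / 2) * ellKernel z t ^ 3)
        + 4 * (z * (1 + z)) * (3 / 4 * ellKernel z t ^ 5) + ellKernel z t := fun t => by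
    have h := ellKernel_sq_mul hz t
    rw [Real.cos_sq']
    generalize ellKernel z t = G at *
    generalize Real.sin t = s at *
    linear_combination (-3 * (1 + 2 * z) * G ^ 3 + 3 * (z + s ^ 2) * G ^ 3 + G) * h
  simp only [e] at key
  rw [intervalIntegral.integral_add, intervalIntegral.integral_add,
    intervalIntegral.integral_const_mul (4 * (1 + 2 * z)),
    intervalIntegral.integral_const_mul (4 * (z * (1 + z)))] at key
  · change 4 * (1 + 2 * z) * ellIntDeriv z + _ + ellInt z = 0 at key
    simp only [id, Pi.mul_apply]
    linear_combination key / 4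
  all_goals exact Continuous.intervalIntegrable (by fun_prop) _ _

/-- The singular part of the elliptic integral is elementary: the primitive is `arsinh (sin t /
√z)`. -/
theorem integral_cos_mul_ellKernel {z : ℝ} (hz : 0 < z) :
    ∫ t in (0 : ℝ)..(Real.pi / 2), Real.cos t * ellKernel z t
      = Real.log (1 + √(1 + z)) - Real.log z / 2 := by
  have hk := continuous_ellKernel hz
  have hs : 0 < √z := Real.sqrt_pos.2 hz
  rw [intervalIntegral.integral_eq_sub_of_hasDerivAt
    (f := fun t => Real.arsinh (Real.sin t / √z))]
  · simp only [Real.sin_pi_div_two, Real.sin_zero, zero_div, Real.arsinh_zero, sub_zero]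
    have e : 1 / √z + √(1 + (1 / √z) ^ 2) = (1 + √(1 + z)) / √z := by
      rw [div_pow, one_pow, Real.sq_sqrt hz.le,
        show 1 + 1 / z = (1 + z) / z by field_simp; ring, Real.sqrt_div (by positivity)]
      ring
    rw [Real.arsinh, e, Real.log_div (by positivity) hs.ne', Real.log_sqrt hz.le]
  · intro t _
    refine ((Real.hasDerivAt_sin t).div_const (√z)).arsinh.congr_deriv ?_
    have h : 0 < z + Real.sin t ^ 2 := by positivity
    rw [ellKernel, div_pow, Real.sq_sqrt hz.le,
      show 1 + Real.sin t ^ 2 / z = (z + Real.sin t ^ 2) / z by field_simp,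
      Real.sqrt_div h.le]
    have := (Real.sqrt_pos.2 h).ne'
    simp only [smul_eq_mul]
    field_simp
  · exact Continuous.intervalIntegrable (by fun_prop) _ _

/-- The factor `1 - cos t` cancels the singularity of the kernel at `t = 0`, uniformly in `z`, as `1
- cos t ≤ sin t` on `[0, π/2]`. Dominated convergence leaves the integral of `(1 - cos t) / sin t =
sin t / (1 + cos t)`. -/
theorem tendsto_integral_one_sub_cos_mul_ellKernel :
    Tendsto (fun z => ∫ t in (0 : ℝ)..(Real.pi / 2), (1 - Real.cos t) * ellKernel z t)
      (𝓝[>] 0) (𝓝 (Real.log 2)) := by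
  have hlim : ∫ t in (0 : ℝ)..(Real.pi / 2), Real.sin t / (1 + Real.cos t) = Real.log 2 := by
    have hpos : ∀ t ∈ uIcc 0 (Real.pi / 2), 0 < 1 + Real.cos t := fun t ht => by
      rw [uIcc_of_le (by positivity)] at ht
      have := Real.cos_nonneg_of_mem_Icc ⟨by linarith [ht.1, Real.pi_pos], ht.2⟩
      linarith
    rw [intervalIntegral.integral_eq_sub_of_hasDerivAt
      (f := fun t => -Real.log (1 + Real.cos t))]
    · norm_num
    · intro t ht
      refine (((Real.hasDerivAt_cos t).const_add 1).log (hpos t ht).ne').neg.congr_deriv ?_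
      ring
    · refine ContinuousOn.intervalIntegrable (ContinuousOn.div (by fun_prop) (by fun_prop) ?_)
      exact fun t ht => (hpos t ht).ne'
  rw [← hlim]
  refine intervalIntegral.tendsto_integral_filter_of_dominated_convergence (fun _ => 1) ?_ ?_
    intervalIntegrable_const ?_
  · filter_upwards [self_mem_nhdsWithin] with z hz
    have := continuous_ellKernel hz
    exact Continuous.aestronglyMeasurable (by fun_prop)
  · filter_upwards [self_mem_nhdsWithin] with z hz
    refine Eventually.of_forall fun t ht => ?_
    have hz : 0 < z := hz
    rw [uIoc_of_le (by positivity)] at ht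
    have hc := Real.cos_nonneg_of_mem_Icc ⟨by linarith [ht.1, Real.pi_pos], ht.2⟩
    have hs := Real.sin_nonneg_of_nonneg_of_le_pi ht.1.le (by linarith [ht.2, Real.pi_pos])
    have h1 := Real.sin_sq_add_cos_sq t
    have h : 0 < z + Real.sin t ^ 2 := by positivity
    have h2 : 1 - Real.cos t ≤ √(z + Real.sin t ^ 2) := by
      refine (le_abs_self _).trans (Real.abs_le_sqrt ?_)
      nlinarith [Real.cos_le_one t]
    rw [ellKernel, ← div_eq_mul_inv, Real.norm_eq_abs,
      abs_of_nonneg (div_nonneg (by linarith [Real.cos_le_one t]) (Real.sqrt_nonneg _))]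
    exact (div_le_one (Real.sqrt_pos.2 h)).2 h2
  · refine Eventually.of_forall fun t ht => ?_
    rw [uIoc_of_le (by positivity)] at ht
    have hc := Real.cos_nonneg_of_mem_Icc ⟨by linarith [ht.1, Real.pi_pos], ht.2⟩
    have hs := Real.sin_pos_of_pos_of_lt_pi ht.1 (by linarith [ht.2, Real.pi_pos])
    have e : Real.sin t / (1 + Real.cos t) = (1 - Real.cos t) * (√(0 + Real.sin t ^ 2))⁻¹ := by
      rw [zero_add, Real.sqrt_sq hs.le, ← div_eq_mul_inv, div_eq_div_iff (by positivity) hs.ne']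
      linear_combination Real.sin_sq_add_cos_sq t
    rw [e]
    refine Tendsto.const_mul _ ?_
    have : ContinuousAt (fun z => (√(z + Real.sin t ^ 2))⁻¹) 0 := by
      refine ContinuousAt.inv₀ (by fun_prop) ?_
      rw [zero_add, Real.sqrt_sq hs.le]
      exact hs.ne'
    exact this.tendsto.mono_left nhdsWithin_le_nhds

theorem tendsto_ellInt_add_log :
    Tendsto (fun z => ellInt z + Real.log z / 2) (𝓝[>] 0) (𝓝 (2 * Real.log 2)) := by
  have h1 : Tendsto (fun z : ℝ => Real.log (1 + √(1 + z))) (𝓝[>] 0) (𝓝 (Real.log 2)) := by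
    have : ContinuousAt (fun z : ℝ => Real.log (1 + √(1 + z))) 0 := by
      refine ContinuousAt.log (by fun_prop) (by positivity)
    have h := this.tendsto.mono_left (nhdsWithin_le_nhds (s := Ioi 0))
    norm_num at h
    exact h
  have h2 := h1.add tendsto_integral_one_sub_cos_mul_ellKernel
  rw [← two_mul] at h2
  refine h2.congr' ?_
  filter_upwards [self_mem_nhdsWithin] with z hz
  have hk := continuous_ellKernel hz
  have e : ellInt z = (∫ t in (0 : ℝ)..(Real.pi / 2), Real.cos t * ellKernel z t)
      + ∫ t in (0 : ℝ)..(Real.pi / 2), (1 - Real.cos t) * ellKernel z t := by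
    rw [← intervalIntegral.integral_add]
    · refine intervalIntegral.integral_congr fun t _ => ?_
      ring
    all_goals exact Continuous.intervalIntegrable (by fun_prop) _ _
  rw [e, integral_cos_mul_ellKernel hz]
  ring

/-- The equation for the elliptic integral in the variable `x`, where `z = 4 x (1 + x)`. -/
theorem isFluxPair_ellInt (ρ : ℝ) :
    IsFluxPair (fun x => 1 + 3 * x + 2 * x ^ 2) (fun x => 1 + 2 * x) ρ
      (fun x => ellInt (4 * x * (1 + x)))
      (fun x => 4 * x * (1 + x) * (1 + 4 * x * (1 + x)) * ellIntDeriv (4 * x * (1 + x))) := by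
  intro x hx
  have hx0 := hx.1
  have hz : 0 < 4 * x * (1 + x) := by positivity
  have hd : HasDerivAt (fun x : ℝ => 4 * x * (1 + x)) (4 * (1 + 2 * x)) x := by
    refine (((hasDerivAt_id x).const_mul 4).mul ((hasDerivAt_id x).const_add 1)).congr_deriv ?_
    simp; ring
  constructor
  · refine ((hasDerivAt_ellInt hz).comp x hd).congr_deriv ?_
    field_simp
    ring
  · refine ((ellInt_legendre hz).comp x hd).congr_deriv ?_
    ring

/-! ### The integrated density of states -/

theorem volume_le_cos (c : ℝ) :
    MeasureTheory.volume {y : ℝ | y ∈ Icc (-Real.pi) Real.pi ∧ c ≤ Real.cos y}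
      = ENNReal.ofReal (2 * Real.arccos c) := by
  rcases lt_or_ge 1 c with hc | hc
  · have e : {y : ℝ | y ∈ Icc (-Real.pi) Real.pi ∧ c ≤ Real.cos y} = ∅ :=
      eq_empty_of_forall_notMem fun y hy => by linarith [hy.2, Real.cos_le_one y]
    rw [e, Real.arccos_of_one_le hc.le]
    simp
  · have e : {y : ℝ | y ∈ Icc (-Real.pi) Real.pi ∧ c ≤ Real.cos y}
        = Icc (-Real.arccos c) (Real.arccos c) := by
      ext y
      simp only [mem_ofPred_eq, mem_Icc, ← abs_le]
      rw [← Real.cos_abs y]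
      constructor
      · rintro ⟨h1, h2⟩
        rw [← Real.arccos_cos (abs_nonneg y) h1]
        exact Real.arccos_le_arccos h2
      · intro h
        have h1 := h.trans (Real.arccos_le_pi c)
        refine ⟨h1, ?_⟩
        have h2 := Real.cos_le_cos_of_nonneg_of_le_pi (abs_nonneg y) (Real.arccos_le_pi c) h
        -- For `c < -1` the convention `arccos c = π` gives the whole interval, as it should.
        rcases le_or_gt (-1) c with h3 | h3
        · rwa [Real.cos_arccos h3 hc] at h2
        · linarith [Real.neg_one_le_cos |y|]
    rw [e, Real.volume_Icc]
    ring_nf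

theorem integratedDOS_eq_integral (ε : ℝ) : integratedDOS ε
    = (∫ k in (-Real.pi)..Real.pi, 2 * Real.arccos (-(ε / 2) - Real.cos k))
      / (2 * Real.pi) ^ 2 := by
  have hcont : Continuous fun k => 2 * Real.arccos (-(ε / 2) - Real.cos k) := by fun_prop
  have hclosed : IsClosed {k : ℝ × ℝ |
      k ∈ Icc (-Real.pi) Real.pi ×ˢ Icc (-Real.pi) Real.pi ∧ band k ≤ ε} := by
    have hb : Continuous band := by unfold band; fun_prop
    have hS : {k : ℝ × ℝ | k ∈ Icc (-Real.pi) Real.pi ×ˢ Icc (-Real.pi) Real.pi ∧ band k ≤ ε}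
        = (Icc (-Real.pi) Real.pi ×ˢ Icc (-Real.pi) Real.pi) ∩ {k | band k ≤ ε} := by
      ext k; simp
    rw [hS]
    exact (isClosed_Icc.prod isClosed_Icc).inter (isClosed_le hb continuous_const)
  rw [integratedDOS, MeasureTheory.Measure.volume_eq_prod,
    MeasureTheory.Measure.prod_apply hclosed.measurableSet]
  have e : ∀ x : ℝ, MeasureTheory.volume (Prod.mk x ⁻¹' {k : ℝ × ℝ |
      k ∈ Icc (-Real.pi) Real.pi ×ˢ Icc (-Real.pi) Real.pi ∧ band k ≤ ε})
      = (Icc (-Real.pi) Real.pi).indicator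
        (fun x => ENNReal.ofReal (2 * Real.arccos (-(ε / 2) - Real.cos x))) x := by
    intro x
    by_cases hx : x ∈ Icc (-Real.pi) Real.pi
    · rw [indicator_of_mem hx, ← volume_le_cos]
      congr 1
      ext y
      simp only [mem_preimage, mem_ofPred_eq, mem_prod, hx, true_and, band]
      refine and_congr_right fun _ => ?_
      constructor <;> intro h <;> linarith
    · rw [indicator_of_notMem hx]
      convert MeasureTheory.measure_empty (μ := (MeasureTheory.volume : MeasureTheory.Measure ℝ))
      refine eq_empty_of_forall_notMem fun y hy => hx hy.1.1
  simp only [e]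
  rw [MeasureTheory.lintegral_indicator measurableSet_Icc,
    ← MeasureTheory.ofReal_integral_eq_lintegral_ofReal,
    ENNReal.toReal_ofReal, MeasureTheory.integral_Icc_eq_integral_Ioc,
    intervalIntegral.integral_of_le (by linarith [Real.pi_pos])]
  · exact MeasureTheory.integral_nonneg fun k => mul_nonneg two_pos.le (Real.arccos_nonneg _)
  · exact hcont.integrableOn_Icc
  · exact Eventually.of_forall fun k => mul_nonneg two_pos.le (Real.arccos_nonneg _)

/-! ### From the area to the elliptic integral -/

theorem arccos_one_sub_two_mul {y : ℝ} (hy : y ≤ 1) :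
    Real.arccos (1 - 2 * y) = 2 * Real.arcsin √y := by
  -- For `y ≤ 0` both sides are `0`: the arccosine is clamped beyond `1` and the square root of a
  -- nonpositive number is `0`.
  rcases le_total y 0 with h | h
  · rw [Real.arccos_of_one_le (by linarith), Real.sqrt_eq_zero_of_nonpos h]
    simp
  · have h1 : √y ≤ 1 := Real.sqrt_le_one.2 hy
    have h0 := Real.sqrt_nonneg y
    have e : 1 - 2 * y = Real.cos (2 * Real.arcsin √y) := by
      rw [Real.cos_two_mul_eq_one_sub, Real.sin_arcsin (by linarith) h1, Real.sq_sqrt h]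
    rw [e, Real.arccos_cos]
    · have := Real.arcsin_nonneg.2 h0
      linarith
    · linarith [Real.arcsin_le_pi_div_two √y]

theorem integral_zero_pi_of_symm {f : ℝ → ℝ} (hf : Continuous f)
    (h : ∀ t, f (Real.pi - t) = f t) :
    ∫ t in (0 : ℝ)..Real.pi, f t = 2 * ∫ t in (0 : ℝ)..(Real.pi / 2), f t := by
  have h1 := intervalIntegral.integral_comp_sub_left (a := 0) (b := Real.pi / 2) f Real.pi
  simp only [h, sub_zero] at h1
  rw [show Real.pi - Real.pi / 2 = Real.pi / 2 by ring] at h1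
  rw [two_mul]
  conv_rhs => arg 2; rw [h1]
  exact (intervalIntegral.integral_add_adjacent_intervals (hf.intervalIntegrable _ _)
    (hf.intervalIntegrable _ _)).symm

/-- The substitution `k = 2t - π` replaces `cos k` by `2 sin² t - 1`, the half-angle formula applies
since `ε ≥ 0`, and the symmetry `t ↦ π - t` halves the interval. -/
theorem integratedDOS_eq_arcsin {ε : ℝ} (hε : 0 ≤ ε) : integratedDOS ε
    = 1 - 4 / Real.pi ^ 2 *
      ∫ t in (0 : ℝ)..(Real.pi / 2), Real.arcsin √(1 - ε / 4 - Real.sin t ^ 2) := by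
  have h1 := intervalIntegral.integral_comp_mul_sub (a := 0) (b := Real.pi)
    (fun k => 2 * Real.arccos (-(ε / 2) - Real.cos k)) (two_ne_zero) Real.pi
  rw [show 2 * 0 - Real.pi = -Real.pi by ring, show 2 * Real.pi - Real.pi = Real.pi by ring] at h1
  have e : ∀ t : ℝ, 2 * Real.arccos (-(ε / 2) - Real.cos (2 * t - Real.pi))
      = 2 * Real.pi - 4 * Real.arcsin √(1 - ε / 4 - Real.sin t ^ 2) := fun t => by
    have := arccos_one_sub_two_mul (y := 1 - ε / 4 - Real.sin t ^ 2)
      (by nlinarith [sq_nonneg (Real.sin t)])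
    rw [Real.cos_sub_pi, Real.cos_two_mul_eq_one_sub,
      show -(ε / 2) - -(1 - 2 * Real.sin t ^ 2)
        = -(1 - 2 * (1 - ε / 4 - Real.sin t ^ 2)) by ring, Real.arccos_neg, this]
    ring
  simp only [e, smul_eq_mul] at h1
  have hc : Continuous fun t : ℝ => Real.arcsin √(1 - ε / 4 - Real.sin t ^ 2) := by fun_prop
  have hc4 : Continuous fun t : ℝ => 4 * Real.arcsin √(1 - ε / 4 - Real.sin t ^ 2) := by fun_prop
  rw [intervalIntegral.integral_sub (by simp) (hc4.intervalIntegrable _ _), intervalIntegral.integral_const_mul 4,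
    integral_zero_pi_of_symm hc (fun t => by rw [Real.sin_pi_sub])] at h1
  simp only [intervalIntegral.integral_const, smul_eq_mul, sub_zero] at h1
  rw [integratedDOS_eq_integral]
  have := Real.pi_ne_zero
  generalize (∫ k in (-Real.pi)..Real.pi, 2 * Real.arccos (-(ε / 2) - Real.cos k)) = I at *
  generalize (∫ t in (0 : ℝ)..(Real.pi / 2), Real.arcsin √(1 - ε / 4 - Real.sin t ^ 2)) = J at *
  field_simp
  linear_combination -2 * h1

/-- The area integral after the substitution `sin a = r sin t`. -/
noncomputable def areaInt (r : ℝ) : ℝ :=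
  ∫ t in (0 : ℝ)..(Real.pi / 2), Real.arcsin (r * Real.cos t)
    * (r * Real.cos t / √(1 - (r * Real.sin t) ^ 2))

theorem one_sub_sq_pos {r : ℝ} (hr : r ∈ Ioo (0 : ℝ) 1) {s : ℝ} (hs : s ^ 2 ≤ 1) :
    0 < 1 - (r * s) ^ 2 := by
  have h1 : r ^ 2 < 1 := by nlinarith [hr.1, hr.2]
  nlinarith [sq_nonneg r, sq_nonneg s, mul_le_mul_of_nonneg_left hs (sq_nonneg r)]

theorem one_sub_mul_sin_sq_pos {r : ℝ} (hr : r ∈ Ioo (0 : ℝ) 1) (t : ℝ) :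
    0 < 1 - (r * Real.sin t) ^ 2 :=
  one_sub_sq_pos hr (Real.sin_sq_le_one t)

theorem one_sub_mul_cos_sq_pos {r : ℝ} (hr : r ∈ Ioo (0 : ℝ) 1) (t : ℝ) :
    0 < 1 - (r * Real.cos t) ^ 2 :=
  one_sub_sq_pos hr (Real.cos_sq_le_one t)

theorem hasDerivAt_arcsin_of_sq_lt {y : ℝ} (h : 0 < 1 - y ^ 2) :
    HasDerivAt Real.arcsin (1 / √(1 - y ^ 2)) y :=
  Real.hasDerivAt_arcsin (fun e => by rw [e] at h; norm_num at h)
    fun e => by rw [e] at h; norm_num at h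

theorem hasDerivAt_arcsin_comp {u : ℝ → ℝ} {u' x : ℝ} (hu : HasDerivAt u u' x)
    (h : 0 < 1 - u x ^ 2) :
    HasDerivAt (fun y => Real.arcsin (u y)) (u' / √(1 - u x ^ 2)) x := by
  refine ((hasDerivAt_arcsin_of_sq_lt h).comp x hu).congr_deriv ?_
  ring

theorem hasDerivAt_sqrt_one_sub_sq {u : ℝ → ℝ} {u' x : ℝ} (hu : HasDerivAt u u' x)
    (h : 0 < 1 - u x ^ 2) :
    HasDerivAt (fun y => √(1 - u y ^ 2)) (-(u x * u') / √(1 - u x ^ 2)) x := by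
  refine (((hu.fun_pow 2).const_sub 1).sqrt h.ne').congr_deriv ?_
  have := (Real.sqrt_pos.2 h).ne'
  field_simp
  push_cast
  ring

theorem integral_arcsin_sqrt {r : ℝ} (hr : r ∈ Ioo (0 : ℝ) 1) :
    ∫ t in (0 : ℝ)..(Real.pi / 2), Real.arcsin √(r ^ 2 - Real.sin t ^ 2) = areaInt r := by
  have hc : Continuous fun t : ℝ => Real.arcsin √(r ^ 2 - Real.sin t ^ 2) := by fun_prop
  have hα := Real.arcsin_nonneg.2 hr.1.le
  have hα' := Real.arcsin_le_pi_div_two r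
  rw [← intervalIntegral.integral_add_adjacent_intervals (b := Real.arcsin r)
    (hc.intervalIntegrable _ _) (hc.intervalIntegrable _ _)]
  -- Beyond `arcsin r` the radicand is nonpositive, so the truncated square root vanishes. The
  -- remaining interval, whose endpoint depends on `r`, is mapped onto `[0, π/2]`.
  have hz : ∫ t in (Real.arcsin r)..(Real.pi / 2), Real.arcsin √(r ^ 2 - Real.sin t ^ 2) = 0 := by
    rw [← intervalIntegral.integral_zero (a := Real.arcsin r) (b := Real.pi / 2)]
    refine intervalIntegral.integral_congr fun t ht => ?_
    rw [uIcc_of_le hα'] at ht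
    have h1 : r ≤ Real.sin t := by
      rw [← Real.sin_arcsin (by linarith [hr.1]) hr.2.le]
      exact Real.sin_le_sin_of_le_of_le_pi_div_two (Real.neg_pi_div_two_le_arcsin r) ht.2 ht.1
    have h2 : r ^ 2 - Real.sin t ^ 2 ≤ 0 := by nlinarith [hr.1]
    simp [Real.sqrt_eq_zero_of_nonpos h2]
  have hd : ∀ t, HasDerivAt (fun t => Real.arcsin (r * Real.sin t))
      (r * Real.cos t / √(1 - (r * Real.sin t) ^ 2)) t := fun t => by
    exact hasDerivAt_arcsin_comp ((Real.hasDerivAt_sin t).const_mul r)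
      (one_sub_mul_sin_sq_pos hr t)
  have hs := intervalIntegral.integral_comp_mul_deriv (a := 0) (b := Real.pi / 2)
    (fun t _ => hd t) (Continuous.continuousOn (Continuous.div (by fun_prop) (by fun_prop)
      fun t => (Real.sqrt_pos.2 (one_sub_mul_sin_sq_pos hr t)).ne')) hc
  simp only [Real.sin_zero, mul_zero, Real.arcsin_zero, Real.sin_pi_div_two, mul_one] at hs
  rw [hz, add_zero, ← hs, areaInt]
  refine intervalIntegral.integral_congr fun t ht => ?_
  rw [uIcc_of_le (by positivity)] at ht
  have hcos := Real.cos_nonneg_of_mem_Icc ⟨by linarith [ht.1, Real.pi_pos], ht.2⟩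
  have h1 := one_sub_mul_sin_sq_pos hr t
  have e : √(r ^ 2 - Real.sin (Real.arcsin (r * Real.sin t)) ^ 2) = r * Real.cos t := by
    rw [Real.sin_arcsin (by nlinarith) (by nlinarith), mul_pow,
      show r ^ 2 - r ^ 2 * Real.sin t ^ 2 = (r * Real.cos t) ^ 2 by rw [mul_pow, Real.cos_sq']; ring,
      Real.sqrt_sq (mul_nonneg hr.1.le hcos)]
  simp only [Function.comp_apply, e]

theorem hasDerivAt_areaInt {r : ℝ} (hr : r ∈ Ioo (0 : ℝ) 1) :
    HasDerivAt areaInt (∫ t in (0 : ℝ)..(Real.pi / 2),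
      r / (√(1 - (r * Real.cos t) ^ 2) * √(1 - (r * Real.sin t) ^ 2))) r := by
  have hcs : ∀ q ∈ Ioo (0 : ℝ) 1 ×ˢ (univ : Set ℝ), √(1 - (q.1 * Real.sin q.2) ^ 2) ≠ 0 :=
    fun q hq => (Real.sqrt_pos.2 (one_sub_mul_sin_sq_pos hq.1 q.2)).ne'
  have hcc : ∀ q ∈ Ioo (0 : ℝ) 1 ×ˢ (univ : Set ℝ), √(1 - (q.1 * Real.cos q.2) ^ 2) ≠ 0 :=
    fun q hq => (Real.sqrt_pos.2 (one_sub_mul_cos_sq_pos hq.1 q.2)).ne'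
  have hs0 : ∀ t, √(1 - (r * Real.sin t) ^ 2) ≠ 0 := fun t => hcs (r, t) ⟨hr, mem_univ _⟩
  have hc0 : ∀ t, √(1 - (r * Real.cos t) ^ 2) ≠ 0 := fun t => hcc (r, t) ⟨hr, mem_univ _⟩
  have hcont : Continuous fun t =>
      r / (√(1 - (r * Real.cos t) ^ 2) * √(1 - (r * Real.sin t) ^ 2)) :=
    Continuous.div (by fun_prop) (by fun_prop) fun t => mul_ne_zero (hc0 t) (hs0 t)
  have hcont' : Continuous fun t => r * Real.cos t ^ 2
        / (√(1 - (r * Real.cos t) ^ 2) * √(1 - (r * Real.sin t) ^ 2))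
      + Real.arcsin (r * Real.cos t) * (Real.cos t / √(1 - (r * Real.sin t) ^ 2)
        + r ^ 2 * Real.cos t * Real.sin t ^ 2 / √(1 - (r * Real.sin t) ^ 2) ^ 3) :=
    Continuous.add (Continuous.div (by fun_prop) (by fun_prop) fun t =>
      mul_ne_zero (hc0 t) (hs0 t)) (Continuous.mul (by fun_prop)
      (Continuous.add (Continuous.div (by fun_prop) (by fun_prop) hs0)
      (Continuous.div (by fun_prop) (by fun_prop) fun t => pow_ne_zero _ (hs0 t))))
  have hd := hasDerivAt_intervalIntegral (a := 0) (b := Real.pi / 2) isOpen_Ioo hr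
    (F := fun r t => Real.arcsin (r * Real.cos t)
      * (r * Real.cos t / √(1 - (r * Real.sin t) ^ 2)))
    (F' := fun r t => r * Real.cos t ^ 2
        / (√(1 - (r * Real.cos t) ^ 2) * √(1 - (r * Real.sin t) ^ 2))
      + Real.arcsin (r * Real.cos t) * (Real.cos t / √(1 - (r * Real.sin t) ^ 2)
        + r ^ 2 * Real.cos t * Real.sin t ^ 2 / √(1 - (r * Real.sin t) ^ 2) ^ 3)) ?_ ?_ ?_
  · refine hd.congr_deriv ?_
    -- The derivative under the integral differs from the symmetric integrand by the `t`-derivative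
    -- of `arcsin (r cos t) sin t / √(1 - r² sin² t)`, which vanishes at `0` and `π/2`.
    rw [← sub_eq_zero, ← intervalIntegral.integral_sub,
      intervalIntegral.integral_eq_sub_of_hasDerivAt (f := fun t => Real.arcsin (r * Real.cos t)
        * (Real.sin t / √(1 - (r * Real.sin t) ^ 2)))]
    · simp
    · intro t _
      have h1 := one_sub_mul_sin_sq_pos hr t
      have h2 := one_sub_mul_cos_sq_pos hr t
      have h3 := (Real.sqrt_pos.2 h1).ne'
      have h4 := (Real.sqrt_pos.2 h2).ne'
      have ds := hasDerivAt_sqrt_one_sub_sq ((Real.hasDerivAt_sin t).const_mul r) h1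
      have da := hasDerivAt_arcsin_comp ((Real.hasDerivAt_cos t).const_mul r) h2
      refine (da.mul ((Real.hasDerivAt_sin t).div ds h3)).congr_deriv ?_
      have hsc := Real.sin_sq_add_cos_sq t
      simp only [Pi.div_apply]
      generalize √(1 - (r * Real.sin t) ^ 2) = S at *
      generalize √(1 - (r * Real.cos t) ^ 2) = C at *
      field_simp
      linear_combination (-r * S ^ 2) * hsc
    · exact (hcont'.sub hcont).intervalIntegrable _ _
    · exact hcont'.intervalIntegrable _ _
    · exact hcont.intervalIntegrable _ _
  · intro x hx
    exact Continuous.mul (by fun_prop) (Continuous.div (by fun_prop) (by fun_prop)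
      fun t => (Real.sqrt_pos.2 (one_sub_mul_sin_sq_pos hx t)).ne')
  · refine ContinuousOn.add (ContinuousOn.div (by fun_prop) (by fun_prop)
      fun q hq => mul_ne_zero (hcc q hq) (hcs q hq)) (ContinuousOn.mul (by fun_prop)
      (ContinuousOn.add (ContinuousOn.div (by fun_prop) (by fun_prop) hcs)
      (ContinuousOn.div (by fun_prop) (by fun_prop) fun q hq => pow_ne_zero _ (hcs q hq))))
  · intro x hx t
    have h1 := one_sub_mul_sin_sq_pos hx t
    have h2 := one_sub_mul_cos_sq_pos hx t
    have h3 := (Real.sqrt_pos.2 h1).ne'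
    have h4 := (Real.sqrt_pos.2 h2).ne'
    have dm : ∀ c, HasDerivAt (fun y : ℝ => y * c) c x := fun c => by
      simpa using (hasDerivAt_id x).mul_const c
    have ds := hasDerivAt_sqrt_one_sub_sq (dm (Real.sin t)) h1
    have da := hasDerivAt_arcsin_comp (dm (Real.cos t)) h2
    refine (da.mul ((dm (Real.cos t)).div ds h3)).congr_deriv ?_
    simp only [Pi.div_apply]
    generalize √(1 - (x * Real.sin t) ^ 2) = S at *
    generalize √(1 - (x * Real.cos t) ^ 2) = C at *
    field_simp
    ring

/-- The product of the two radicands is `1 - r² + (r⁴/4) sin² 2t`. Doubling the angle and using the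
symmetry about `π/2` gives the standard kernel. -/
theorem integral_eq_ellInt {r : ℝ} (hr : r ∈ Ioo (0 : ℝ) 1) :
    ∫ t in (0 : ℝ)..(Real.pi / 2),
      r / (√(1 - (r * Real.cos t) ^ 2) * √(1 - (r * Real.sin t) ^ 2))
      = 2 / r * ellInt (4 * (1 - r ^ 2) / r ^ 4) := by
  have hr0 := hr.1
  have hz : 0 < 4 * (1 - r ^ 2) / r ^ 4 := by
    have : 0 < 1 - r ^ 2 := by nlinarith [hr.1, hr.2]
    positivity
  have hk := continuous_ellKernel hz
  have e : ∀ t, r / (√(1 - (r * Real.cos t) ^ 2) * √(1 - (r * Real.sin t) ^ 2))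
      = 2 / r * ellKernel (4 * (1 - r ^ 2) / r ^ 4) (2 * t) := fun t => by
    have h2 := one_sub_mul_cos_sq_pos hr t
    have e1 : (1 - (r * Real.cos t) ^ 2) * (1 - (r * Real.sin t) ^ 2)
        = (r ^ 2 / 2) ^ 2 * (4 * (1 - r ^ 2) / r ^ 4 + Real.sin (2 * t) ^ 2) := by
      rw [Real.sin_two_mul]
      field_simp
      linear_combination (-4 * r ^ 2) * Real.sin_sq_add_cos_sq t
    rw [← Real.sqrt_mul h2.le, e1, Real.sqrt_mul (by positivity), Real.sqrt_sq (by positivity),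
      ellKernel]
    field_simp
  simp only [e]
  rw [intervalIntegral.integral_const_mul,
    intervalIntegral.integral_comp_mul_left (fun t => ellKernel _ t) two_ne_zero, mul_zero,
    mul_div_cancel₀ _ (two_ne_zero' ℝ), integral_zero_pi_of_symm hk, ellInt]
  · simp
  · intro t
    rw [ellKernel, ellKernel, Real.sin_pi_sub]

/-- Chain rule with `r = √(1 - ε/4)`; the elliptic parameter `4(1 - r²)/r⁴ = 16ε/(4-ε)²` equals
`4x(1+x)` for `x = ε/(4-ε)`. -/
theorem hasDerivAt_integratedDOS {ε : ℝ} (hε : ε ∈ Ioo (0 : ℝ) 4) :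
    HasDerivAt integratedDOS (4 / (Real.pi ^ 2 * (4 - ε))
      * ellInt (4 * (ε / (4 - ε)) * (1 + ε / (4 - ε)))) ε := by
  have hr : ∀ e ∈ Ioo (0 : ℝ) 4, √(1 - e / 4) ∈ Ioo (0 : ℝ) 1 := fun e he =>
    ⟨Real.sqrt_pos.2 (by linarith [he.2]), by
      rw [Real.sqrt_lt' one_pos]; linarith [he.1]⟩
  have heq : integratedDOS =ᶠ[𝓝 ε] fun e => 1 - 4 / Real.pi ^ 2 * areaInt √(1 - e / 4) := by
    filter_upwards [isOpen_Ioo.mem_nhds hε] with e he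
    rw [integratedDOS_eq_arcsin he.1.le, ← integral_arcsin_sqrt (hr e he),
      Real.sq_sqrt (by linarith [he.2])]
  refine HasDerivAt.congr_of_eventuallyEq ?_ heq
  have hp : 0 < 1 - ε / 4 := by linarith [hε.2]
  have hd : HasDerivAt (fun e : ℝ => √(1 - e / 4)) (-(1 / 4) / (2 * √(1 - ε / 4))) ε :=
    (((hasDerivAt_id ε).div_const 4).const_sub 1).sqrt hp.ne'
  refine ((((hasDerivAt_areaInt (hr ε hε)).comp ε hd).const_mul
    (4 / Real.pi ^ 2)).const_sub 1).congr_deriv ?_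
  have hpi := Real.pi_ne_zero
  have h4 : 4 - ε ≠ 0 := by linarith [hε.2]
  have hs := (Real.sqrt_pos.2 hp).ne'
  have hs2 := Real.sq_sqrt hp.le
  rw [integral_eq_ellInt (hr ε hε)]
  have ez : 4 * (1 - √(1 - ε / 4) ^ 2) / √(1 - ε / 4) ^ 4
      = 4 * (ε / (4 - ε)) * (1 + ε / (4 - ε)) := by
    rw [show √(1 - ε / 4) ^ 4 = (√(1 - ε / 4) ^ 2) ^ 2 by ring, hs2]
    rw [show 1 - ε / 4 = (4 - ε) / 4 by ring]
    field_simp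
    ring
  rw [ez]
  generalize ellInt _ = E
  generalize √(1 - ε / 4) = r at *
  have : (4 - ε) = 4 * r ^ 2 := by linarith
  rw [this]
  field_simp

/-! ### Identification of the elliptic integral with Frobenius series -/

theorem tendsto_log_mul_self_nhdsGT_zero :
    Tendsto (fun t : ℝ => Real.log t * t) (𝓝[>] 0) (𝓝 0) := by
  simpa using tendsto_log_mul_rpow_nhdsGT_zero one_pos

theorem GeomBounded.powerSum_eq {R : ℝ} {c : ℕ → ℝ} (hR : 0 ≤ R) (hc : GeomBounded R c) {t : ℝ}
    (ht : R * |t| < 1) (M : ℕ) : powerSum c t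
      = ∑ m ∈ Finset.range M, c m * t ^ m + t ^ M * powerSum (fun m => c (m + M)) t := by
  have h := (hc.hasSum hR ht).summable
  rw [powerSum, ← h.sum_add_tsum_nat_add M, powerSum, ← tsum_mul_left]
  congr 1
  exact tsum_congr fun m => by ring

theorem eventually_mul_abs_lt_one (R : ℝ) : ∀ᶠ t in 𝓝[>] (0 : ℝ), R * |t| < 1 := by
  have : ContinuousAt (fun t : ℝ => R * |t|) 0 := by fun_prop
  exact nhdsWithin_le_nhds (this.eventually (gt_mem_nhds (by simp)))

theorem powerSum_zero (c : ℕ → ℝ) : powerSum c 0 = c 0 := by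
  rw [powerSum, tsum_eq_single 0 fun m hm => by simp [hm]]
  simp

theorem GeomBounded.tendsto {R : ℝ} {c : ℕ → ℝ} (hR : 0 < R) (hc : GeomBounded R c) :
    Tendsto (powerSum c) (𝓝[>] 0) (𝓝 (c 0)) := by
  rw [← powerSum_zero c]
  exact (hc.analyticAt hR).continuousAt.tendsto.mono_left nhdsWithin_le_nhds

/-- The behaviour at `0⁺` of a Frobenius solution. -/
theorem tendsto_frobenius_sub_log {R : ℝ} {c b : ℕ → ℝ} (hR : 0 < R) (hc : GeomBounded R c)
    (hb : GeomBounded R b) (h1 : c 0 = 1) :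
    Tendsto (fun t => powerSum c t * Real.log t + powerSum b t - Real.log t)
      (𝓝[>] 0) (𝓝 (b 0)) := by
  have h2 := (((hc.add_right 1).tendsto hR).mul
    tendsto_log_mul_self_nhdsGT_zero).add (hb.tendsto hR)
  simp only [mul_zero, zero_add] at h2
  refine h2.congr' ?_
  filter_upwards [eventually_mul_abs_lt_one R] with t ht
  rw [hc.powerSum_eq hR.le ht 1]
  simp [h1]
  ring

/-- Existence of the two Frobenius solutions. -/
theorem exists_frobenius {p₁ p₂ r₀ r₁ ρ₀ R : ℝ} {c b : ℕ → ℝ} (hρ₀ : 0 < ρ₀) (hR : 0 < R)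
    (hc : GeomBounded R c) (hb : GeomBounded R b)
    (hrc : ∀ m : ℕ, (m + 1 : ℝ) ^ 2 * c (m + 1) + (p₁ * (m * (m + 1)) + r₀) * c m
      + (p₂ * (m ^ 2 - 1) + r₁) * shiftCoeff c m = 0)
    (hrb : ∀ m : ℕ, (m + 1 : ℝ) ^ 2 * b (m + 1) + (p₁ * (m * (m + 1)) + r₀) * b m
      + (p₂ * (m ^ 2 - 1) + r₁) * shiftCoeff b m
      + (2 * (m + 1) * c (m + 1) + p₁ * (2 * m + 1) * c m + 2 * p₂ * m * shiftCoeff c m) = 0)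
    (hp : ∀ t ∈ Ioo 0 ρ₀, 1 + p₁ * t + p₂ * t ^ 2 ≠ 0) :
    ∃ ρ, 0 < ρ ∧ ρ ≤ ρ₀ ∧ ∃ w w₁,
      IsFluxPair (fun t => 1 + p₁ * t + p₂ * t ^ 2) (fun t => r₀ + r₁ * t) ρ
        (fun t => powerSum c t * Real.log t + powerSum b t) w ∧
      IsFluxPair (fun t => 1 + p₁ * t + p₂ * t ^ 2) (fun t => r₀ + r₁ * t) ρ (powerSum c) w₁ := by
  have hρ : 4 * R * min ρ₀ (1 / (4 * R)) ≤ 1 := by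
    calc 4 * R * min ρ₀ (1 / (4 * R)) ≤ 4 * R * (1 / (4 * R)) := by gcongr; exact min_le_right _ _
      _ = 1 := by field_simp
  have hp' : ∀ t ∈ Ioo 0 (min ρ₀ (1 / (4 * R))), 1 + p₁ * t + p₂ * t ^ 2 ≠ 0 := fun t ht =>
    hp t ⟨ht.1, ht.2.trans_le (min_le_left _ _)⟩
  obtain ⟨w, hw⟩ := isFluxPair_frobenius hR hc hb hrc hrb hρ hp'
  -- With zero logarithmic part the second recursion becomes the homogeneous one, so the regular
  -- solution is a special case of the same construction.
  have hsz : ∀ m, shiftCoeff (fun _ : ℕ => (0 : ℝ)) m = 0 := fun m => by cases m <;> rfl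
  obtain ⟨w₁, hw₁⟩ := isFluxPair_frobenius (c := fun _ => 0) hR ⟨0, by simp⟩ hc
    (by simp [hsz]) (by simpa [hsz] using hrc) hρ hp'
  refine ⟨_, lt_min hρ₀ (by positivity), min_le_left _ _, w, w₁, hw, ?_⟩
  have e : (fun t => powerSum (fun _ => 0) t * Real.log t + powerSum c t) = powerSum c := by
    funext t
    simp [powerSum]
  rwa [e] at hw₁

/-- The rate is `9 = 1 + (3 + 1) + (2 + 2)`, from the four constants of the recursion. -/
theorem geomBounded_diagCoeff : GeomBounded 9 diagCoeff :=
  geomBounded_of_recurrence (p₁ := 3) (p₂ := 2) (r₀ := 1) (r₁ := 2) (ε := 0) (f := fun _ => 0)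
    (by norm_num) (by simp) fun m => by simpa using diagCoeff_recurrence m

theorem geomBounded_diagLogCoeff : GeomBounded 9 diagLogCoeff :=
  geomBounded_of_log_recurrence (p₁ := 3) (p₂ := 2) (r₀ := 1) (r₁ := 2) (by norm_num)
    geomBounded_diagCoeff diagLogCoeff_recurrence

theorem exists_frobenius_diag : ∃ ρ, 0 < ρ ∧ ∃ w w₁,
      IsFluxPair (fun x => 1 + 3 * x + 2 * x ^ 2) (fun x => 1 + 2 * x) ρ
        (fun t => powerSum diagCoeff t * Real.log t + powerSum diagLogCoeff t) w ∧
      IsFluxPair (fun x => 1 + 3 * x + 2 * x ^ 2) (fun x => 1 + 2 * x) ρ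
        (powerSum diagCoeff) w₁ := by
  obtain ⟨ρ, h, -, h'⟩ := exists_frobenius one_pos (by norm_num) geomBounded_diagCoeff
    geomBounded_diagLogCoeff diagCoeff_recurrence diagLogCoeff_recurrence
    fun t ht => by have := ht.1; positivity
  exact ⟨ρ, h, h'⟩

/-- The behaviour of the elliptic integral at `z = 4 x (1 + x)` as `x → 0⁺`. -/
theorem tendsto_ellInt_comp_add_log :
    Tendsto (fun x => ellInt (4 * x * (1 + x)) + Real.log x / 2) (𝓝[>] 0)
      (𝓝 (Real.log 2)) := by
  have ht : Tendsto (fun x : ℝ => 4 * x * (1 + x)) (𝓝[>] 0) (𝓝[>] 0) := by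
    refine tendsto_nhdsWithin_iff.2 ⟨?_, ?_⟩
    · have : ContinuousAt (fun x : ℝ => 4 * x * (1 + x)) 0 := by fun_prop
      have h := this.tendsto.mono_left (nhdsWithin_le_nhds (s := Ioi 0))
      simpa using h
    · filter_upwards [self_mem_nhdsWithin] with x hx
      have : (0 : ℝ) < x := hx
      exact mem_Ioi.2 (by positivity)
  have hl : Tendsto (fun x : ℝ => Real.log (1 + x)) (𝓝[>] 0) (𝓝 0) := by
    have : ContinuousAt (fun x : ℝ => Real.log (1 + x)) 0 :=
      ContinuousAt.log (by fun_prop) (by norm_num)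
    have h := this.tendsto.mono_left (nhdsWithin_le_nhds (s := Ioi 0))
    simpa using h
  have h := ((tendsto_ellInt_add_log.comp ht).sub (hl.div_const 2)).sub_const (Real.log 2)
  rw [show 2 * Real.log 2 - 0 / 2 - Real.log 2 = Real.log 2 by ring] at h
  refine h.congr' ?_
  filter_upwards [self_mem_nhdsWithin] with x hx
  have hx : (0 : ℝ) < x := hx
  have h4 : Real.log 4 = 2 * Real.log 2 := by
    rw [show (4 : ℝ) = 2 ^ 2 by norm_num, Real.log_pow]; norm_num
  simp only [Function.comp_apply]
  rw [Real.log_mul (by positivity) (by positivity), Real.log_mul (by norm_num) hx.ne', h4]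
  ring

/-- A solution in the variable `x` with the right logarithmic singularity is the elliptic
integral. -/
theorem eventually_ellInt_eq {y w : ℝ → ℝ} {ρ κ : ℝ} (hρ : 0 < ρ)
    (h : IsFluxPair (fun x => 1 + 3 * x + 2 * x ^ 2) (fun x => 1 + 2 * x) ρ y w)
    (hy : Tendsto (fun x => κ * y x - Real.log x / 2) (𝓝[>] 0) (𝓝 (-Real.log 2))) :
    ∀ᶠ x in 𝓝[>] (0 : ℝ), ellInt (4 * x * (1 + x)) = -(κ * y x) := by
  obtain ⟨ρ', hρ', w', w₁, -, h₁⟩ := exists_frobenius_diag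
  have hmono : ∀ {σ τ : ℝ} {u v : ℝ → ℝ}, σ ≤ τ →
      IsFluxPair (fun x => 1 + 3 * x + 2 * x ^ 2) (fun x => 1 + 2 * x) τ u v →
      IsFluxPair (fun x => 1 + 3 * x + 2 * x ^ 2) (fun x => 1 + 2 * x) σ u v :=
    fun hστ hu t ht => hu t ⟨ht.1, ht.2.trans_le hστ⟩
  have hp : Tendsto (fun x : ℝ => 1 + 3 * x + 2 * x ^ 2) (𝓝[>] 0) (𝓝 1) := by
    have : ContinuousAt (fun x : ℝ => 1 + 3 * x + 2 * x ^ 2) 0 := by fun_prop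
    have h := this.tendsto.mono_left (nhdsWithin_le_nhds (s := Ioi 0))
    simpa using h
  have hlim := tendsto_ellInt_comp_add_log.add hy
  rw [add_neg_cancel] at hlim
  have hreg := geomBounded_diagCoeff.tendsto (by norm_num)
  rw [diagCoeff_zero] at hreg
  have key := IsFluxPair.eventually_eq_zero (lt_min hρ hρ') hp
    ((isFluxPair_ellInt (min ρ ρ')).linear_combination (hmono (min_le_left _ _) h) κ)
    (hmono (min_le_right _ _) h₁) (hlim.congr fun x => by ring) hreg
  filter_upwards [key] with x hx
  linarith

/-- The factor `1/2` matches the singularity `-(log x)/2`, and the constant matches because `ψ(1/2)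
- ψ(1) = -2 log 2`. -/
theorem eventually_ellInt_eq_diag : ∀ᶠ x in 𝓝[>] (0 : ℝ), ellInt (4 * x * (1 + x))
    = -(1 / 2 * (powerSum diagCoeff x * Real.log x + powerSum diagLogCoeff x)) := by
  obtain ⟨ρ, hρ, w, w₁, h, -⟩ := exists_frobenius_diag
  refine eventually_ellInt_eq hρ h ?_
  have := (tendsto_frobenius_sub_log (by norm_num) geomBounded_diagCoeff geomBounded_diagLogCoeff
    diagCoeff_zero).const_mul (1 / 2)
  rw [diagLogCoeff_zero, show 1 / 2 * (-2 * Real.log 2) = -Real.log 2 by ring] at this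
  exact this.congr fun x => by ring

/-! ### Legendre's series and Landen's transformation -/

/-- The Taylor coefficients `((1/2)_j / j!)²` of the complete elliptic integral. -/
noncomputable def legendreCoeff : ℕ → ℝ
  | 0 => 1
  | j + 1 => ((j + 1 / 2) / (j + 1)) ^ 2 * legendreCoeff j

/-- The logarithmic derivatives in `j` of `legendreCoeff`, up to a constant. -/
noncomputable def legendreLog : ℕ → ℝ
  | 0 => -4 * Real.log 2
  | j + 1 => legendreLog j + 2 / (j + 1 / 2) - 2 / (j + 1)

theorem legendreCoeff_recurrence (m : ℕ) :
    (m + 1 : ℝ) ^ 2 * legendreCoeff (m + 1) + (-1 * (m * (m + 1)) + -(1 / 4)) * legendreCoeff m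
      + (0 * ((m : ℝ) ^ 2 - 1) + 0) * shiftCoeff legendreCoeff m = 0 := by
  have h1 : (m : ℝ) + 1 ≠ 0 := by positivity
  rw [legendreCoeff]
  field_simp
  ring

theorem legendreLogCoeff_recurrence (m : ℕ) :
    (m + 1 : ℝ) ^ 2 * (legendreCoeff (m + 1) * legendreLog (m + 1))
      + (-1 * (m * (m + 1)) + -(1 / 4)) * (legendreCoeff m * legendreLog m)
      + (0 * ((m : ℝ) ^ 2 - 1) + 0) * shiftCoeff (fun m => legendreCoeff m * legendreLog m) m
      + (2 * (m + 1) * legendreCoeff (m + 1) + -1 * (2 * m + 1) * legendreCoeff m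
        + 2 * 0 * m * shiftCoeff legendreCoeff m) = 0 := by
  have h1 : (m : ℝ) + 1 ≠ 0 := by positivity
  have h2 : (m : ℝ) + 1 / 2 ≠ 0 := by positivity
  have h3 : 2 * (m : ℝ) + 1 ≠ 0 := by positivity
  rw [legendreCoeff, legendreLog]
  field_simp
  ring

theorem geomBounded_legendreCoeff : GeomBounded 9 legendreCoeff :=
  geomBounded_of_recurrence (p₁ := -1) (p₂ := 0) (r₀ := -(1 / 4)) (r₁ := 0) (ε := 0)
    (f := fun _ => 0) (by norm_num [abs_of_pos]) (by simp) fun m => by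
      simpa using legendreCoeff_recurrence m

theorem geomBounded_legendreLogCoeff :
    GeomBounded 9 fun m => legendreCoeff m * legendreLog m :=
  geomBounded_of_log_recurrence (p₁ := -1) (p₂ := 0) (r₀ := -(1 / 4)) (r₁ := 0)
    (by norm_num [abs_of_pos]) geomBounded_legendreCoeff legendreLogCoeff_recurrence

/-- Landen's transformation, on the level of differential equations. -/
theorem IsFluxPair.landen {y w : ℝ → ℝ} {ρ : ℝ} (hρ : ρ ≤ 1)
    (h : IsFluxPair (fun t => 1 + -1 * t + 0 * t ^ 2) (fun t => -(1 / 4) + 0 * t) ρ y w) :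
    IsFluxPair (fun x => 1 + 3 * x + 2 * x ^ 2) (fun x => 1 + 2 * x) ρ
      (fun x => y ((x / (1 + x)) ^ 2) / (1 + x))
      (fun x => -(x * (1 + 2 * x) / (1 + x)) * y ((x / (1 + x)) ^ 2)
        + 2 * (1 + x) * w ((x / (1 + x)) ^ 2)) := by
  intro x hx
  have hx0 := hx.1
  have h1 : (1 : ℝ) + x ≠ 0 := by positivity
  have h2 : (1 : ℝ) + 2 * x ≠ 0 := by positivity
  -- With `q = x/(1+x)` one has `q < x < ρ ≤ 1`, hence `q² < q < ρ`.
  have hv : (x / (1 + x)) ^ 2 ∈ Ioo 0 ρ := by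
    refine ⟨by positivity, ?_⟩
    have h3 : x / (1 + x) < x := div_lt_self hx0 (by linarith)
    have h4 : 0 < x / (1 + x) := by positivity
    nlinarith [hx.2]
  have d1 : HasDerivAt (fun x : ℝ => 1 + x) 1 x := (hasDerivAt_id x).const_add 1
  have dq : HasDerivAt (fun x : ℝ => (x / (1 + x)) ^ 2) (2 * x / (1 + x) ^ 3) x := by
    refine (((hasDerivAt_id x).fun_div d1 h1).fun_pow 2).congr_deriv ?_
    simp only [id, Nat.cast_ofNat, Nat.add_one_sub_one, pow_one]
    field_simp
    ring
  have dy := (h _ hv).1.comp x dq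
  have dw := (h _ hv).2.comp x dq
  have dc : HasDerivAt (fun x : ℝ => -(x * (1 + 2 * x) / (1 + x)))
      (-((1 + 4 * x + 2 * x ^ 2) / (1 + x) ^ 2)) x := by
    refine (((hasDerivAt_id x).mul (((hasDerivAt_id x).const_mul 2).const_add 1)).div d1
      h1).neg.congr_deriv ?_
    simp only [id, Pi.mul_apply]
    field_simp
    ring
  have e : 1 + -1 * (x / (1 + x)) ^ 2 + 0 * ((x / (1 + x)) ^ 2) ^ 2
      = (1 + 2 * x) / (1 + x) ^ 2 := by
    field_simp
    ring
  dsimp only at dy dw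
  rw [e] at dy
  constructor
  · refine (dy.div d1 h1).congr_deriv ?_
    simp only [Function.comp_apply]
    rw [show 1 + 3 * x + 2 * x ^ 2 = (1 + x) * (1 + 2 * x) by ring]
    field_simp
    ring
  · refine ((dc.mul dy).add ((d1.const_mul 2).mul dw)).congr_deriv ?_
    simp only [Function.comp_apply]
    field_simp
    ring

/-- Since `log v = 2 log x + o(1)`, the factor is now `1/4`, and the initial value `-4 log 2` of
`legendreLog` produces the required constant `-log 2`. -/
theorem eventually_ellInt_eq_legendre : ∀ᶠ x in 𝓝[>] (0 : ℝ), ellInt (4 * x * (1 + x))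
    = -(1 / 4 * ((powerSum legendreCoeff ((x / (1 + x)) ^ 2) * Real.log ((x / (1 + x)) ^ 2)
        + powerSum (fun m => legendreCoeff m * legendreLog m) ((x / (1 + x)) ^ 2)) / (1 + x))) := by
  obtain ⟨ρ, hρ, hρ1, w, w₁, h, -⟩ := exists_frobenius one_pos (by norm_num)
    geomBounded_legendreCoeff geomBounded_legendreLogCoeff legendreCoeff_recurrence
    legendreLogCoeff_recurrence (fun t ht => by have := ht.2; intro h; linarith)
  refine eventually_ellInt_eq hρ (h.landen hρ1) ?_
  have ht : Tendsto (fun x : ℝ => (x / (1 + x)) ^ 2) (𝓝[>] 0) (𝓝[>] 0) := by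
    refine tendsto_nhdsWithin_iff.2 ⟨?_, ?_⟩
    · have : ContinuousAt (fun x : ℝ => (x / (1 + x)) ^ 2) 0 := by
        refine ContinuousAt.pow (ContinuousAt.div (by fun_prop) (by fun_prop) (by norm_num)) 2
      have h := this.tendsto.mono_left (nhdsWithin_le_nhds (s := Ioi 0))
      simpa using h
    · filter_upwards [self_mem_nhdsWithin] with x hx
      have : (0 : ℝ) < x := hx
      exact mem_Ioi.2 (by positivity)
  have h1x : Tendsto (fun x : ℝ => 1 + x) (𝓝[>] 0) (𝓝 1) := by
    have : ContinuousAt (fun x : ℝ => 1 + x) 0 := by fun_prop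
    have h := this.tendsto.mono_left (nhdsWithin_le_nhds (s := Ioi 0))
    simpa using h
  have hl : Tendsto (fun x : ℝ => Real.log (1 + x)) (𝓝[>] 0) (𝓝 0) := by
    simpa using h1x.log one_ne_zero
  have hF := (tendsto_frobenius_sub_log (by norm_num) geomBounded_legendreCoeff
    geomBounded_legendreLogCoeff (by rw [legendreCoeff])).comp ht
  have hsum := (((hF.sub (hl.const_mul 2)).sub
    ((tendsto_log_mul_self_nhdsGT_zero).const_mul 2)).div h1x one_ne_zero).const_mul (1 / 4)
  have e0 : 1 / 4 * ((legendreCoeff 0 * legendreLog 0 - 2 * 0 - 2 * 0) / 1) = -Real.log 2 := by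
    rw [legendreCoeff, legendreLog]; ring
  rw [e0] at hsum
  refine hsum.congr' ?_
  filter_upwards [self_mem_nhdsWithin] with x hx
  have hx : (0 : ℝ) < x := hx
  have e : Real.log ((x / (1 + x)) ^ 2) = 2 * Real.log x - 2 * Real.log (1 + x) := by
    rw [Real.log_pow, Real.log_div hx.ne' (by positivity)]
    push_cast
    ring
  simp only [Function.comp_apply, Pi.div_apply, e]
  field_simp
  ring

/-! ### Asymptotic expansion of the density of states -/

/-- The `(k,l)`-term of half the double series, as a function of `x`. -/
noncomputable def pairTerm (p : ℕ × ℕ) (x : ℝ) : ℝ :=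
  x ^ (p.1 + p.2) * (pairCoeff p.1 p.2 * Real.log x + pairLogCoeff p.1 p.2)

theorem isLogPower_pairTerm {M : ℕ} {p : ℕ × ℕ} (h : M ≤ p.1 + p.2) :
    IsLogPower M (pairTerm p) := by
  refine ⟨fun t => t ^ (p.1 + p.2 - M) * pairCoeff p.1 p.2,
    fun t => t ^ (p.1 + p.2 - M) * pairLogCoeff p.1 p.2,
    (analyticAt_id.pow _).mul analyticAt_const, (analyticAt_id.pow _).mul analyticAt_const,
    Eventually.of_forall fun t => ?_⟩
  have e : t ^ (p.1 + p.2) = t ^ M * t ^ (p.1 + p.2 - M) := by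
    rw [← pow_add, Nat.add_sub_cancel' h]
  simp only [pairTerm, zpow_natCast, e]
  ring

/-- Splitting both power series after `M` terms leaves `t ^ M` times series that are again
geometrically bounded, hence analytic at `0`. -/
theorem isLogPower_tail {R : ℝ} {c b : ℕ → ℝ} (hR : 0 < R) (hc : GeomBounded R c)
    (hb : GeomBounded R b) (M : ℕ) :
    IsLogPower M fun t => powerSum c t * Real.log t + powerSum b t
      - ∑ m ∈ Finset.range M, t ^ m * (c m * Real.log t + b m) := by
  refine ⟨_, _, (hc.add_right M).analyticAt hR, (hb.add_right M).analyticAt hR, ?_⟩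
  filter_upwards [eventually_mul_abs_lt_one R] with t ht
  rw [hc.powerSum_eq hR.le ht M, hb.powerSum_eq hR.le ht M]
  simp only [mul_add, Finset.sum_add_distrib, zpow_natCast, add_mul, Finset.sum_mul]
  have e1 : ∀ m, t ^ m * (c m * Real.log t) = c m * t ^ m * Real.log t := fun m => by ring
  have e2 : ∀ m, t ^ m * b m = b m * t ^ m := fun m => by ring
  simp only [e1, e2]
  ring

/-- The terms of `S` of degree below `M` fill complete antidiagonals; all other terms of `S` are
already of the size of the error. -/
theorem sum_pairTerm_eq {M : ℕ} {S : Finset (ℕ × ℕ)} (hS : ∀ k l : ℕ, k + l < M → (k, l) ∈ S)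
    (x : ℝ) : ∑ p ∈ S, pairTerm p x
      = ∑ m ∈ Finset.range M, x ^ m * (diagCoeff m * Real.log x + diagLogCoeff m)
        + ∑ p ∈ S with ¬ p.1 + p.2 < M, pairTerm p x := by
  rw [← Finset.sum_filter_add_sum_filter_not S (fun p => p.1 + p.2 < M)]
  congr 1
  rw [← Finset.sum_fiberwise_of_maps_to (t := Finset.range M) (g := fun p : ℕ × ℕ => p.1 + p.2)
    (fun p hp => Finset.mem_range.2 (Finset.mem_filter.1 hp).2)]
  refine Finset.sum_congr rfl fun m hm => ?_
  have e : {p ∈ {p ∈ S | p.1 + p.2 < M} | p.1 + p.2 = m}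
      = Finset.HasAntidiagonal.antidiagonal m := by
    ext p
    simp only [Finset.mem_filter, Finset.HasAntidiagonal.mem_antidiagonal]
    refine ⟨fun h => h.2, fun h => ⟨⟨hS _ _ ?_, ?_⟩, h⟩⟩ <;>
    · rw [h]; exact Finset.mem_range.1 hm
  rw [e, diagCoeff, diagLogCoeff, Finset.sum_mul, ← Finset.sum_add_distrib, Finset.mul_sum]
  refine Finset.sum_congr rfl fun p hp => ?_
  rw [pairTerm, Finset.HasAntidiagonal.mem_antidiagonal.1 hp]

theorem isLogPower_sub_sum_pairTerm {M : ℕ} {S : Finset (ℕ × ℕ)}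
    (hS : ∀ k l : ℕ, k + l < M → (k, l) ∈ S) :
    IsLogPower M fun x => powerSum diagCoeff x * Real.log x + powerSum diagLogCoeff x
      - ∑ p ∈ S, pairTerm p x := by
  have h1 := isLogPower_tail (by norm_num) geomBounded_diagCoeff geomBounded_diagLogCoeff M
  have h2 := IsLogPower.sum (j := M) {p ∈ S | ¬ p.1 + p.2 < M} (f := pairTerm) fun p hp =>
    isLogPower_pairTerm (not_lt.1 (Finset.mem_filter.1 hp).2)
  refine (h1.sub h2).congr (Eventually.of_forall fun x => ?_)
  rw [sum_pairTerm_eq hS]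
  ring

theorem analyticAt_inv_four_sub : AnalyticAt ℝ (fun ε : ℝ => (4 - ε)⁻¹) 0 :=
  (analyticAt_const.sub analyticAt_id).inv (by norm_num)

theorem IsLogPower.comp_div_four_sub {M : ℕ} {f : ℝ → ℝ} (hf : IsLogPower M f) (κ : ℝ) :
    IsLogPower M fun ε => κ / (Real.pi ^ 2 * (4 - ε)) * f (ε / (4 - ε)) := by
  have h := (hf.comp_mul analyticAt_inv_four_sub (by norm_num)).mul_analytic
    (g := fun ε => κ / Real.pi ^ 2 * (4 - ε)⁻¹)
    (analyticAt_const.mul analyticAt_inv_four_sub)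
  refine h.congr (Eventually.of_forall fun ε => ?_)
  rw [div_mul_eq_div_div, ← div_eq_mul_inv, ← div_eq_mul_inv]

theorem expansionTerm_eq {ε : ℝ} (hε : ε ≠ 4) (k l : ℕ) :
    expansionTerm k l ε
      = -2 / (Real.pi ^ 2 * (4 - ε)) * pairTerm (k, l) (ε / (4 - ε)) := by
  have h4 : 4 - ε ≠ 0 := sub_ne_zero.2 hε.symm
  rw [expansionTerm, show 4 / (4 - ε) = 1 + ε / (4 - ε) by field_simp; ring, A_neg_one_add,
    pairTerm]
  ring

theorem eventually_ne_four : ∀ᶠ ε in 𝓝[>] (0 : ℝ), ε ∈ Ioo (0 : ℝ) 4 :=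
  Ioo_mem_nhdsGT (by norm_num)

theorem isLogPower_expansionTerm (k l : ℕ) : IsLogPower 0 (expansionTerm k l) := by
  refine (((isLogPower_pairTerm (M := 0) (p := (k, l)) (Nat.zero_le _)).comp_div_four_sub
    (-2)).zero_of_nat).congr ?_
  filter_upwards [eventually_ne_four] with ε hε
  exact expansionTerm_eq hε.2.ne k l

theorem dos_eq_ellInt {ε : ℝ} (hε : ε ∈ Ioo (0 : ℝ) 4) : dos ε
    = 4 / (Real.pi ^ 2 * (4 - ε)) * ellInt (4 * (ε / (4 - ε)) * (1 + ε / (4 - ε))) :=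
  (hasDerivAt_integratedDOS hε).deriv

theorem tendsto_div_four_sub :
    Tendsto (fun ε : ℝ => ε / (4 - ε)) (𝓝[>] 0) (𝓝[>] 0) := by
  refine tendsto_nhdsWithin_iff.2 ⟨?_, ?_⟩
  · have : ContinuousAt (fun ε : ℝ => ε / (4 - ε)) 0 :=
      ContinuousAt.div (by fun_prop) (by fun_prop) (by norm_num)
    have h := this.tendsto.mono_left (nhdsWithin_le_nhds (s := Ioi 0))
    simpa using h
  · filter_upwards [eventually_ne_four] with ε hε
    exact div_pos hε.1 (by linarith [hε.2])

theorem isLogPower_dos_sub_sum {M : ℕ} {S : Finset (ℕ × ℕ)}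
    (hS : ∀ k l : ℕ, k + l < M → (k, l) ∈ S) :
    IsLogPower M fun ε => dos ε - ∑ p ∈ S, expansionTerm p.1 p.2 ε := by
  refine ((isLogPower_sub_sum_pairTerm hS).comp_div_four_sub (-2)).congr ?_
  filter_upwards [eventually_ne_four, tendsto_div_four_sub.eventually eventually_ellInt_eq_diag]
    with ε hε he
  rw [dos_eq_ellInt hε, he, Finset.sum_congr rfl fun p _ => expansionTerm_eq hε.2.ne p.1 p.2,
    ← Finset.mul_sum]
  ring

theorem isLogPower_dos : IsLogPower 0 dos := by
  simpa using isLogPower_dos_sub_sum (M := 0) (S := ∅) (by simp)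

/-- The first terms of the expansion in the variable `v = (ε / 4) ^ 2`. -/
theorem firstTerms_eq {ε : ℝ} (hε : 0 < ε) : firstTerms ε
    = -1 / (4 * Real.pi ^ 2) * ∑ m ∈ Finset.range 6, ((ε / 4) ^ 2) ^ m
      * (legendreCoeff m * Real.log ((ε / 4) ^ 2) + legendreCoeff m * legendreLog m) := by
  have h1 : Real.log (16 / ε) = 4 * Real.log 2 - Real.log ε := by
    rw [Real.log_div (by norm_num) hε.ne', show (16 : ℝ) = 2 ^ 4 by norm_num, Real.log_pow]
    norm_num
  have h2 : Real.log ((ε / 4) ^ 2) = 2 * Real.log ε - 4 * Real.log 2 := by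
    rw [Real.log_pow, Real.log_div hε.ne' (by norm_num), show (4 : ℝ) = 2 ^ 2 by norm_num,
      Real.log_pow]
    push_cast
    ring
  have hpi := Real.pi_ne_zero
  rw [firstTerms, h1, h2]
  simp only [Finset.sum_range_succ, Finset.sum_range_zero, legendreCoeff, legendreLog]
  generalize Real.log 2 = L2
  generalize Real.log ε = L
  field_simp
  norm_num
  ring

theorem isLogPower_dos_sub_firstTerms : IsLogPower (12 : ℕ) fun ε => dos ε - firstTerms ε := by
  have hv : AnalyticAt ℝ (fun ε : ℝ => (ε / 4) ^ 2) 0 := (analyticAt_id.div_const).pow 2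
  have hA := (geomBounded_legendreCoeff.add_right 6).analyticAt (by norm_num)
  have hB := (geomBounded_legendreLogCoeff.add_right 6).analyticAt (by norm_num)
  have hA' : AnalyticAt ℝ
      (fun ε : ℝ => powerSum (fun m => legendreCoeff (m + 6)) ((ε / 4) ^ 2)) 0 :=
    AnalyticAt.fun_comp (by simpa using hA) hv
  have hB' : AnalyticAt ℝ (fun ε : ℝ => powerSum
      (fun m => legendreCoeff (m + 6) * legendreLog (m + 6)) ((ε / 4) ^ 2)) 0 :=
    AnalyticAt.fun_comp (by simpa using hB) hv
  have hvt : Tendsto (fun ε : ℝ => (ε / 4) ^ 2) (𝓝[>] 0) (𝓝[>] 0) := by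
    refine tendsto_nhdsWithin_iff.2 ⟨?_, ?_⟩
    · have h := hv.continuousAt.tendsto.mono_left (nhdsWithin_le_nhds (s := Ioi 0))
      simpa using h
    · filter_upwards [self_mem_nhdsWithin] with ε hε
      have : (0 : ℝ) < ε := hε
      exact mem_Ioi.2 (by positivity)
  -- The prefactor `-1/(4π²)` times `v⁶ = (ε/4)¹²` gives `4 ^ 13`. Below, `log v = 2 log ε - 4 log
  -- 2` distributes the logarithmic tail over the two analytic coefficients.
  have hκ : AnalyticAt ℝ (fun _ : ℝ => -1 / (4 ^ 13 * Real.pi ^ 2)) 0 := analyticAt_const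
  refine ⟨_, _, hκ.mul (hA'.mul (analyticAt_const (v := (2 : ℝ)))),
    hκ.mul ((hA'.mul (analyticAt_const (v := -4 * Real.log 2))).add hB'), ?_⟩
  filter_upwards [eventually_ne_four,
    tendsto_div_four_sub.eventually eventually_ellInt_eq_legendre,
    hvt.eventually (eventually_mul_abs_lt_one 9)] with ε hε he hs
  have h4 : 4 - ε ≠ 0 := by linarith [hε.2]
  have e1 : 1 + ε / (4 - ε) = 4 / (4 - ε) := by field_simp; ring
  have e2 : ε / (4 - ε) / (4 / (4 - ε)) = ε / 4 := by field_simp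
  have h2 : Real.log ((ε / 4) ^ 2) = 2 * Real.log ε - 4 * Real.log 2 := by
    rw [Real.log_pow, Real.log_div hε.1.ne' (by norm_num), show (4 : ℝ) = 2 ^ 2 by norm_num,
      Real.log_pow]
    push_cast
    ring
  rw [dos_eq_ellInt hε, he, firstTerms_eq hε.1, e1, e2,
    geomBounded_legendreCoeff.powerSum_eq (by norm_num) hs 6,
    geomBounded_legendreLogCoeff.powerSum_eq (by norm_num) hs 6]
  have e3 : ∑ m ∈ Finset.range 6, ((ε / 4) ^ 2) ^ m
      * (legendreCoeff m * Real.log ((ε / 4) ^ 2) + legendreCoeff m * legendreLog m)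
      = (∑ m ∈ Finset.range 6, legendreCoeff m * ((ε / 4) ^ 2) ^ m) * Real.log ((ε / 4) ^ 2)
        + ∑ m ∈ Finset.range 6, legendreCoeff m * legendreLog m * ((ε / 4) ^ 2) ^ m := by
    rw [Finset.sum_mul, ← Finset.sum_add_distrib]
    exact Finset.sum_congr rfl fun m _ => by ring
  rw [e3, h2]
  simp only [Pi.mul_apply, Pi.add_apply, zpow_natCast]
  have hpi := Real.pi_ne_zero
  field_simp
  ring

end Hubbard

theorem theorem2p0 :
    (∀ ε ∈ Set.Ioo (0 : ℝ) 4, DifferentiableAt ℝ Hubbard.integratedDOS ε) ∧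
    (∀ᶠ ε in 𝓝[>] (0 : ℝ), ContDiffAt ℝ ∞ Hubbard.dos ε) ∧
    (∀ (n M : ℕ) (S : Finset (ℕ × ℕ)), (∀ k l : ℕ, k + l < M → (k, l) ∈ S) →
      (fun ε : ℝ => iteratedDeriv n Hubbard.dos ε
          - ∑ p ∈ S, iteratedDeriv n (Hubbard.expansionTerm p.1 p.2) ε)
        =O[𝓝[>] (0 : ℝ)] (fun ε : ℝ => ε ^ ((M : ℤ) - (n : ℤ)) * Real.log (1 / ε))) ∧
    (∀ n : ℕ,
      (fun ε : ℝ => iteratedDeriv n Hubbard.dos ε - iteratedDeriv n Hubbard.firstTerms ε)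
        =O[𝓝[>] (0 : ℝ)] (fun ε : ℝ => ε ^ ((12 : ℤ) - (n : ℤ)) * Real.log (1 / ε))) := by
  refine ⟨fun ε hε => (Hubbard.hasDerivAt_integratedDOS hε).differentiableAt,
    Hubbard.isLogPower_dos.contDiffAt, fun n M S hS => ?_, fun n => ?_⟩
  · exact Hubbard.isBigO_iteratedDeriv_sub_sum S
      (fun p _ => Hubbard.isLogPower_expansionTerm p.1 p.2) (Hubbard.isLogPower_dos_sub_sum hS) n
  · have h0 : Hubbard.IsLogPower 0 Hubbard.firstTerms :=
      (Hubbard.isLogPower_dos.sub Hubbard.isLogPower_dos_sub_firstTerms.zero_of_nat).congr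
        (Filter.Eventually.of_forall fun ε => by ring)
    -- All explicit terms are treated as one summand, indexed by a one-point type.
    have h := Hubbard.isBigO_iteratedDeriv_sub_sum (M := 12) (f := Hubbard.dos)
      (g := fun _ : Unit => Hubbard.firstTerms) {()} (fun _ _ => h0)
      (by simpa using Hubbard.isLogPower_dos_sub_firstTerms) n
    simpa using h
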